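/- **Product graphs.** A product graph consists of a finite directed graph $G=(V,E)$, a dimension $\mathfrak d(v)$ for each vertex, an input vector $\mathbf X_v\in\mathbb R^{\mathfrak d(v)}$ for each vertex and an input matrix $\mathbf X_e\in\mathbb R^{\mathfrak d(u)\times\mathfrak d(v)}$ for each edge $e$ from $u$ to $v$ (loops and multiple edges are allowed). Its value is $$\mathbf W_G=\sum_{(i_v)_{v\in V}}\ \prod_{e=(u,v)\in E}[\mathbf X_e]_{i_ui_v}\prod_{v\in V}[\mathbf X_v]_{i_v},\qquad i_v\in\{1,\dots,\mathfrak d(v)\}.$$ For each $N$ let $(W_\ell)_{\ell\ge 0}$ be independent random $N\times N$ matrices, $W_\ell$ having i.i.d. $\mathcal N(0,\sigma_\ell^2)$ entries with $\sigma_\ell=\sigma_\ell(N)>0$. We consider product graphs in which all vertices have dimension $N$ and the all-ones vector $\mathbf 1_N$ as input, and every edge has as input either one of the matrices $W_\ell$ (with label $\ell=\ell(e)$ not depending on $N$) or the deterministic $N\times N$ all-ones matrix. Let $E_{\mathcal W}\subseteq E$ be the set of edges with a random input, and put $$\sigma_G=\prod_{e\in E_{\mathcal W}}\sigma_{\ell(e)},\qquad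 \check e(G)=\tfrac12|E_{\mathcal W}|+|E\setminus E_{\mathcal W}|.$$ **Pairings.** An admissible pairing of $G$ is a partition $\phi$ of $E_{\mathcal W}$ into pairs of edges with the same label. $G_\phi$ is the directed multigraph obtained from $G$ by identifying the edges paired by $\phi$ coherently with their orientations (sources with sources, targets with targets). Connectedness and being a tree (connected, without cycles; loops and pairs of parallel or opposite edges count as cycles) are understood with orientations ignored. Let $G_1,\dots,G_c$ be the connected components of $G$. * $\phi$ is fully-atomic if for every $i$ the random edges of $G_i$ are paired between themselves and $G_i$ with its paired edges identified is a tree. * $\phi$ is bi-atomic if for every $i$ there is a $j\ne i$ such that the random edges of $G_i\sqcup G_j$ are paired between themselves and $G_i\sqcup G_j$ with its paired edges identified is a tree. The sets of fully-atomic and bi-atomic admissible pairings are denoted $\mathcal P_{\mathrm A}(G)$ and $\mathcal P_{\mathrm B}(G)$; $G\sqcup H$ is the disjoint union. **Theorem.** Let $(G_i)_{i\ge1}$ be a sequence of connected product graphs as above. Then for every $m\ge1$ the matrix $C$ with entries $C_{ij}=|\mathcal P_{\mathrm B}(G_i\sqcup G_j)|$, $1\le i,j\le m$, is positive semidefinite,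 and, as $N\to\infty$, $$\Big(\big(\sigma_{G_i}N^{\check e(G_i)+\frac12}\big)^{-1}\mathbf W_{G_i}-|\mathcal P_{\mathrm A}(G_i)|\sqrt N\Big)_{i=1}^m\ \xrightarrow{\ d\ }\ \mathbf Z=(Z_1,\dots,Z_m)^\top,$$ where $\mathbf Z$ is a centred Gaussian vector with covariance matrix $\mathbb E[\mathbf Z\mathbf Z^\top]=C$. -/

import Mathlib

open MeasureTheory ProbabilityTheory Filter

noncomputable section

/-- A finite directed graph. Loops and several edges between the same vertices are allowed
(they appear when edges are identified); a graph with `E ⊆ V × V` is a special case. An edge `e`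
is directed from `src e` to `tgt e`. -/
structure DirectedGraph where
  V : Type
  E : Type
  [fintypeV : Fintype V]
  [fintypeE : Fintype E]
  src : E → V
  tgt : E → V

attribute [instance] DirectedGraph.fintypeV DirectedGraph.fintypeE

namespace DirectedGraph

/-- The simple graph on `G.V` in which two distinct vertices are adjacent iff `G` has an edge
between them, in one direction or the other. -/
def toSimple (G : DirectedGraph) : SimpleGraph G.V :=
  SimpleGraph.fromRel fun u v => ∃ e, G.src e = u ∧ G.tgt e = v

/-- Connectedness, orientations being ignored. -/
def Connected (G : DirectedGraph) : Prop := G.toSimple.Connected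

/-- A tree, orientations being ignored: a connected graph without cycles. A loop and a pair of
edges with the same end points (in either orientation) are cycles. -/
def IsTree (G : DirectedGraph) : Prop :=
  G.toSimple.IsTree ∧ (∀ e, G.src e ≠ G.tgt e) ∧
    Function.Injective fun e => s(G.src e, G.tgt e)

/-- The subgraph induced by a set of vertices. -/
def restrict (G : DirectedGraph) (S : Set G.V) : DirectedGraph where
  V := {v : G.V // v ∈ S}
  E := {e : G.E // G.src e ∈ S ∧ G.tgt e ∈ S}
  fintypeV := Fintype.ofFinite _
  fintypeE := Fintype.ofFinite _
  src e := ⟨G.src e.1, e.2.1⟩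
  tgt e := ⟨G.tgt e.1, e.2.2⟩

/-- The vertices that are directly identified when every edge `e` is identified with `φ e`
coherently with the orientations: source with source and target with target. -/
def VertexRel (G : DirectedGraph) (φ : G.E → G.E) (u v : G.V) : Prop :=
  ∃ e, (u = G.src e ∧ v = G.src (φ e)) ∨ (u = G.tgt e ∧ v = G.tgt (φ e))

/-- The graph obtained from `G` by identifying every edge `e` with the edge `φ e`, coherently
with the orientations. -/
def identify (G : DirectedGraph) (φ : G.E → G.E) : DirectedGraph where
  V := Quot (G.VertexRel φ)
  E := Quot fun e e' : G.E => e' = φ e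
  fintypeV := Fintype.ofFinite _
  fintypeE := Fintype.ofFinite _
  src := Quot.map G.src fun e _ h => ⟨e, Or.inl ⟨rfl, congrArg G.src h⟩⟩
  tgt := Quot.map G.tgt fun e _ h => ⟨e, Or.inr ⟨rfl, congrArg G.tgt h⟩⟩

/-- `φ` maps the edges inside the vertex set `S` to edges inside `S`. -/
def PreservesEdgesOf (G : DirectedGraph) (φ : G.E → G.E) (S : Set G.V) : Prop :=
  ∀ e, G.src e ∈ S ∧ G.tgt e ∈ S → G.src (φ e) ∈ S ∧ G.tgt (φ e) ∈ S

/-- The restriction of `φ` to the edges of the subgraph induced by `S`. -/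
def restrictEdgeMap (G : DirectedGraph) {φ : G.E → G.E} {S : Set G.V}
    (h : G.PreservesEdgesOf φ S) : (G.restrict S).E → (G.restrict S).E :=
  fun e => ⟨φ e.1, h e.1 e.2⟩

end DirectedGraph

/-- A product graph: a directed graph with a dimension and an input vector for each vertex, and
an input matrix for each edge. -/
structure ProductGraph extends DirectedGraph where
  dim : V → ℕ
  vertexInput : (v : V) → Fin (dim v) → ℝ
  edgeInput : (e : E) → Matrix (Fin (dim (src e))) (Fin (dim (tgt e))) ℝ

open Classical in
/-- The value `∑_i ∏_{e = (u, v)} [X_e]_{i_u i_v} ∏_v [X_v]_{i_v}` of a product graph. -/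
def ProductGraph.value (G : ProductGraph) : ℝ :=
  ∑ i : ((v : G.V) → Fin (G.dim v)),
    (∏ e, G.edgeInput e (i (G.src e)) (i (G.tgt e))) * ∏ v, G.vertexInput v (i v)

/-- A directed graph whose edges are labelled: `label e = some ℓ` means that the input of `e` is
the random matrix `W_ℓ`, and `label e = none` that it is the deterministic all-ones matrix. -/
structure LabelledGraph extends DirectedGraph where
  label : E → Option ℕ

namespace LabelledGraph

/-- The product graph given by a labelled graph and `N × N` matrices `W_0, W_1, …`: all vertices
have dimension `N` and the all-ones vector as input. -/
def toProductGraph (G : LabelledGraph) (N : ℕ) (W : ℕ → Matrix (Fin N) (Fin N) ℝ) :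
    ProductGraph where
  toDirectedGraph := G.toDirectedGraph
  dim _ := N
  vertexInput _ _ := 1
  edgeInput e := (G.label e).elim (Matrix.of fun _ _ => 1) W

/-- The disjoint union of two labelled graphs. -/
def disjUnion (G H : LabelledGraph) : LabelledGraph where
  V := G.V ⊕ H.V
  E := G.E ⊕ H.E
  src := Sum.map G.src H.src
  tgt := Sum.map G.tgt H.tgt
  label := Sum.elim G.label H.label

/-- `σ_G`, the product of the `σ_{ℓ(e)}` over the edges `e` with a random input. -/
def stdProd (G : LabelledGraph) (σ : ℕ → ℝ) : ℝ :=
  ∏ e, (G.label e).elim 1 σ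

/-- The number `|E_W| / 2 + |E ∖ E_W|`, where `E_W` is the set of edges with a random input.
It is a half-integer when `|E_W|` is odd. -/
def edgeExponent (G : LabelledGraph) : ℝ :=
  ({e : G.E | G.label e ≠ none}.ncard : ℝ) / 2 + ({e : G.E | G.label e = none}.ncard : ℝ)

/-- The admissible pairings of the set `E_W` of edges with a random input: only edges with the
same label are paired. A partition of `E_W` into pairs is represented by the involution that
exchanges the two edges of each pair and fixes the edges outside `E_W`. -/
def pairings (G : LabelledGraph) : Set (G.E → G.E) :=
  {φ | Function.Involutive φ ∧ (∀ e, φ e = e ↔ G.label e = none) ∧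
    ∀ e, G.label (φ e) = G.label e}

/-- The fully-atomic pairings: each connected component is paired within itself and becomes a
tree when the paired edges are identified. -/
def atomicPairings (G : LabelledGraph) : Set (G.E → G.E) :=
  {φ | φ ∈ G.pairings ∧ ∀ c : G.toSimple.ConnectedComponent,
    ∃ h : G.PreservesEdgesOf φ c.supp,
      ((G.restrict c.supp).identify (G.restrictEdgeMap h)).IsTree}

/-- The bi-atomic pairings: for each connected component there is another one such that the edges
of the two are paired between themselves, and the union of the two becomes a tree when the paired
edges are identified. -/
def biatomicPairings (G : LabelledGraph) : Set (G.E → G.E) :=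
  {φ | φ ∈ G.pairings ∧ ∀ c : G.toSimple.ConnectedComponent, ∃ c', c' ≠ c ∧
    ∃ h : G.PreservesEdgesOf φ (c.supp ∪ c'.supp),
      ((G.restrict (c.supp ∪ c'.supp)).identify (G.restrictEdgeMap h)).IsTree}

end LabelledGraph

/-- `W_0, W_1, …` are independent random `N × N` matrices, `W_ℓ` having independent
`𝒩(0, σ_ℓ²)` entries. -/
structure IsGaussianMatrixSequence {Ω : Type*} [MeasurableSpace Ω] (P : Measure Ω) {N : ℕ}
    (σ : ℕ → ℝ) (W : Ω → ℕ → Matrix (Fin N) (Fin N) ℝ) : Prop where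
  hasLaw : ∀ ℓ a b, HasLaw (fun ω => W ω ℓ a b) (gaussianReal 0 ⟨σ ℓ ^ 2, sq_nonneg _⟩) P
  indep : iIndepFun (fun (p : ℕ × Fin N × Fin N) ω => W ω p.1 p.2.1 p.2.2) P

/-- The rescaled and centred value
`(σ_G N^{ě + 1/2})⁻¹ W_G - |P_A(G)| √N` for given matrices `W`, where `ě` is the
number `edgeExponent` of `G`. -/
def rescaledValue (G : LabelledGraph) (N : ℕ) (σ : ℕ → ℝ)
    (W : ℕ → Matrix (Fin N) (Fin N) ℝ) : ℝ :=
  (G.stdProd σ * (N : ℝ) ^ (G.edgeExponent + 1 / 2))⁻¹ * (G.toProductGraph N W).value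
    - (G.atomicPairings.ncard : ℝ) * √(N : ℝ)

/-- The matrix with entries `|P_B(G_i ⊔ G_j)|`. -/
def biatomicMatrix (G : ℕ → LabelledGraph) (m : ℕ) : Matrix (Fin m) (Fin m) ℝ :=
  Matrix.of fun i j => (((G i).disjUnion (G j)).biatomicPairings.ncard : ℝ)

end

noncomputable section

set_option linter.unusedSectionVars false

open scoped Topology

/-! ### Moments of real Gaussian variables and counts of fixed point free involutions -/

/-! Expand the value of a graph as a sum, over index maps `i : V → Fin N`, of monomials in standard
Gaussian entries. Wick's formula (`IsStdGaussianFamily.integral_prod`) turns an expectation into a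
count of couples (index map, pairing) in which the map is constant on glued vertices. Exchanging the
two sums, each pairing `φ` contributes `N` to the number of vertices of the glued graph. The number
of edges of that graph is the same for all pairings, namely `edgeExponent`. After normalisation the
order of a contribution is therefore governed by vertices minus edges, which is at most the number
of components.

For one connected graph the glued graph is connected. Trees contribute exactly `√N` each, and all
other pairings at most `N ^ (-1/2)`; so the mean is `|P_A| √N + o(1)`.

For a joint moment of `k` centred values, inclusion-exclusion (`integral_prod_centred`) removes
every pairing for which one of the `k` graphs is paired within itself. Each component of the glued
graph then contains at least two of them, so there are at most `k / 2` components and no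
contribution grows. A contribution survives in the limit only if the graphs are matched two by two
(`card_identify_le`). For `k = 2` the survivors are the bi-atomic pairings, which gives `C` as
limiting covariance.

The limits of higher moments are not computed. Instead, a product of two expectations is also a sum
over pairings, those respecting a splitting of the graphs into two blocks. A surviving pairing
matches a fixed graph `a` with exactly one `b`, whence `E ∏ Y_j - ∑_b E[Y_a Y_b] E[∏_{j ≠ a, b} Y_j]
→ 0`. With the covariance limits, this makes the moments of every linear combination converge to
Gaussian moments. Taylor expansion turns this into convergence of characteristic functions, and
Lévy's theorem concludes. The matrix `C` is positive semidefinite as a limit of covariance matrices.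
-/

/-- This is the Leibniz rule applied to `f' = c t f`. At `t = 0` the first term vanishes and the
recursion for Gaussian moments remains. -/
lemma iteratedDeriv_gaussian_mgf (c : ℝ) (n : ℕ) (t : ℝ) :
    iteratedDeriv (n + 2) (fun t : ℝ => Real.exp (c * t ^ 2 / 2)) t =
      c * t * iteratedDeriv (n + 1) (fun t : ℝ => Real.exp (c * t ^ 2 / 2)) t +
        (n + 1) * c * iteratedDeriv n (fun t : ℝ => Real.exp (c * t ^ 2 / 2)) t := by
  have hd : ∀ n s, DifferentiableAt ℝ
      (iteratedDeriv n (fun t : ℝ => Real.exp (c * t ^ 2 / 2))) s := fun n s => by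
    have : ContDiff ℝ ⊤ (fun t : ℝ => Real.exp (c * t ^ 2 / 2)) := by fun_prop
    exact (this.differentiable_iteratedDeriv n (by exact WithTop.coe_lt_top _)) s
  have h1 : iteratedDeriv 1 (fun t : ℝ => Real.exp (c * t ^ 2 / 2)) =
      fun t => c * t * Real.exp (c * t ^ 2 / 2) := by
    rw [iteratedDeriv_one]
    ext s
    have : HasDerivAt (fun t : ℝ => c * t ^ 2 / 2) (c * s) s := by
      have := ((hasDerivAt_pow 2 s).const_mul c).div_const 2
      exact this.congr_deriv (by push_cast; ring)
    rw [this.exp.deriv]; ring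
  induction n generalizing t with
  | zero =>
    rw [iteratedDeriv_succ, h1, iteratedDeriv_zero]
    have h := (((hasDerivAt_id t).const_mul c)).mul ((hd 0 t).hasDerivAt)
    rw [iteratedDeriv_zero, ← iteratedDeriv_one, h1] at h
    simp only [id, mul_one] at h
    have h2 := h.deriv
    simp only [Pi.mul_def] at h2
    rw [h2]
    push_cast; ring
  | succ n ih =>
    rw [iteratedDeriv_succ]
    conv_lhs => rw [funext ih]
    have h := ((((hasDerivAt_id t).const_mul c)).mul ((hd (n + 1) t).hasDerivAt)).add
      (((hd n t).hasDerivAt).const_mul ((n + 1) * c))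
    have h2 := h.deriv
    simp only [Pi.mul_def, Pi.add_def, id] at h2
    rw [h2, ← iteratedDeriv_succ, ← iteratedDeriv_succ]
    push_cast; ring

lemma integral_pow_gaussianReal_add_two (v : NNReal) (n : ℕ) :
    ∫ x, x ^ (n + 2) ∂(gaussianReal 0 v) = (n + 1) * v * ∫ x, x ^ n ∂(gaussianReal 0 v) := by
  have h : ∀ k, ∫ x, x ^ k ∂(gaussianReal 0 v) =
      iteratedDeriv k (fun t : ℝ => Real.exp (v * t ^ 2 / 2)) 0 := fun k => by
    have := iteratedDeriv_mgf_zero (X := id) (μ := gaussianReal 0 v) (by simp) k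
    rw [mgf_id_gaussianReal] at this
    simpa using this.symm
  rw [h, h, iteratedDeriv_gaussian_mgf]
  simp

/-- The number of fixed point free involutions of a set with `n` elements, which is also the
`n`-th moment of the standard Gaussian distribution. -/
def matchingNumber : ℕ → ℕ
  | 0 => 1
  | 1 => 0
  | n + 2 => (n + 1) * matchingNumber n

lemma integral_pow_gaussianReal_one (n : ℕ) :
    ∫ x, x ^ n ∂(gaussianReal 0 1) = matchingNumber n := by
  induction n using matchingNumber.induct with
  | case1 => simp [matchingNumber]
  | case2 => simp [matchingNumber]
  | case3 n ih =>
    rw [integral_pow_gaussianReal_add_two, ih]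
    simp [matchingNumber]

/-- The closed form `(2m)! / (2^m m!)`, written so as to match the formula for the number of
permutations of a given cycle type. -/
lemma matchingNumber_two_mul (m : ℕ) :
    matchingNumber (2 * m) * (2 ^ m * m.factorial) = (2 * m).factorial := by
  induction m with
  | zero => simp [matchingNumber]
  | succ m ih =>
    rw [show 2 * (m + 1) = 2 * m + 2 by ring, matchingNumber, Nat.factorial_succ m,
      Nat.factorial_succ (2 * m + 1), Nat.factorial_succ (2 * m), ← ih]
    ring

lemma matchingNumber_odd (m : ℕ) : matchingNumber (2 * m + 1) = 0 := by
  induction m with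
  | zero => simp [matchingNumber]
  | succ m ih =>
    rw [show 2 * (m + 1) + 1 = 2 * m + 1 + 2 by ring, matchingNumber, ih, mul_zero]

/-- On `2m` points these maps are the permutations of cycle type `2, …, 2`. On an odd number of
points there are none, since an involution has even support. -/
lemma card_involutive_fixedPointFree (α : Type*) [Finite α] :
    Nat.card {φ : α → α // Function.Involutive φ ∧ ∀ a, φ a ≠ a} =
      matchingNumber (Nat.card α) := by
  classical
  have := Fintype.ofFinite α
  let e : {φ : α → α // Function.Involutive φ ∧ ∀ a, φ a ≠ a} ≃
      {σ : Equiv.Perm α // σ ^ 2 = 1 ∧ ∀ a, σ a ≠ a} :=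
    { toFun := fun φ => ⟨φ.2.1.toPerm, by
        refine ⟨?_, φ.2.2⟩
        ext a
        simp [pow_two, φ.2.1 a]⟩
      invFun := fun σ => ⟨σ.1, fun a => by
        have := congrArg (fun τ : Equiv.Perm α => τ a) σ.2.1
        simpa [pow_two] using this, σ.2.2⟩
      left_inv := fun φ => by ext; rfl
      right_inv := fun σ => by ext; rfl }
  rw [Nat.card_congr e]
  have hsupp : ∀ σ : Equiv.Perm α, (∀ a, σ a ≠ a) ↔ σ.support = Finset.univ := fun σ => by
    simp [Finset.eq_univ_iff_forall]
  rw [Nat.card_eq_fintype_card (α := α)]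
  obtain ⟨m, hm | hm⟩ := Nat.even_or_odd' (Fintype.card α)
  · have h1 : ∀ σ : Equiv.Perm α, (σ ^ 2 = 1 ∧ ∀ a, σ a ≠ a) ↔
        σ.cycleType = Multiset.replicate m 2 := fun σ => by
      constructor
      · rintro ⟨h2, h3⟩
        have h4 := Equiv.Perm.cycleType_of_pow_prime_eq_one (p := 2) h2
        have h5 := σ.sum_cycleType
        rw [(hsupp σ).1 h3, Finset.card_univ, hm, h4, Multiset.sum_replicate, smul_eq_mul] at h5
        rw [h4]
        congr 1
        omega
      · intro h
        refine ⟨(Equiv.Perm.pow_prime_eq_one_iff (p := 2)).2 fun c hc => ?_, (hsupp σ).2 ?_⟩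
        · rw [h] at hc
          exact Multiset.eq_of_mem_replicate hc
        · rw [← Finset.card_eq_iff_eq_univ, ← σ.sum_cycleType, h, hm]
          simp [mul_comm]
    have h2 := Equiv.Perm.card_of_cycleType_mul_eq α (Multiset.replicate m 2)
    rw [if_pos] at h2
    · rw [Nat.card_congr (Equiv.subtypeEquivRight h1), Nat.card_eq_fintype_card,
        Fintype.card_subtype]
      have h3 := matchingNumber_two_mul m
      rw [hm] at h2 ⊢
      refine Nat.eq_of_mul_eq_mul_right (by positivity) (Eq.trans ?_ (h2.trans h3.symm))
      simp only [Multiset.sum_replicate, smul_eq_mul, Multiset.prod_replicate]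
      rcases m with _ | m
      · simp
      · rw [Multiset.toFinset_replicate, if_neg (by omega)]
        simp [mul_comm 2]
    · constructor
      · simp [hm, mul_comm]
      · intro a ha
        rw [Multiset.eq_of_mem_replicate ha]
  · rw [hm, matchingNumber_odd]
    refine Nat.card_eq_zero.2 (Or.inl ⟨fun σ => ?_⟩)
    have h1 := Equiv.Perm.two_dvd_card_support σ.2.1
    rw [(hsupp σ.1).1 σ.2.2, Finset.card_univ, hm] at h1
    omega

/-! ### Pairings of a labelled set -/

/-- The pairings of the elements `e` with `κ e ≠ none` that only pair elements with the same
label, as involutions that fix the other elements. -/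
def labelPairings {E K : Type*} (κ : E → Option K) : Set (E → E) :=
  {φ | Function.Involutive φ ∧ (∀ e, φ e = e ↔ κ e = none) ∧ ∀ e, κ (φ e) = κ e}

/-- A pairing that preserves the fibres of `q` is a family of pairings of the fibres. -/
def labelPairingsFibreEquiv {E K B : Type*} (κ : E → Option K) (q : E → B) :
    {φ : E → E // φ ∈ labelPairings κ ∧ ∀ e, q (φ e) = q e} ≃
      ((b : B) → labelPairings fun e : {e // q e = b} => κ e) where
  toFun φ b := ⟨fun e => ⟨φ.1 e, (φ.2.2 e).trans e.2⟩, fun e => Subtype.ext (φ.2.1.1 e),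
    fun e => by rw [← φ.2.1.2.1 e, Subtype.ext_iff], fun e => φ.2.1.2.2 e⟩
  invFun ψ := ⟨fun e => ((ψ (q e)).1 ⟨e, rfl⟩).1, by
    have key : ∀ b (e : E) (he : q e = b), ((ψ (q e)).1 ⟨e, rfl⟩).1 = ((ψ b).1 ⟨e, he⟩).1 := by
      rintro _ e rfl; rfl
    refine ⟨⟨fun e => ?_, fun e => ?_, fun e => (ψ (q e)).2.2.2 ⟨e, rfl⟩⟩,
      fun e => ((ψ (q e)).1 ⟨e, rfl⟩).2⟩
    · dsimp only
      rw [key (q e) _ ((ψ (q e)).1 ⟨e, rfl⟩).2]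
      exact congrArg Subtype.val ((ψ (q e)).2.1 ⟨e, rfl⟩)
    · rw [← (ψ (q e)).2.2.1 ⟨e, rfl⟩, Subtype.ext_iff]⟩
  left_inv φ := rfl
  right_inv ψ := by
    funext b
    ext ⟨e, rfl⟩
    rfl

lemma card_labelPairings_fibres {E K B : Type*} [Fintype B] (κ : E → Option K) (q : E → B) :
    Nat.card {φ : E → E // φ ∈ labelPairings κ ∧ ∀ e, q (φ e) = q e} =
      ∏ b, Nat.card (labelPairings fun e : {e // q e = b} => κ e) := by
  rw [Nat.card_congr (labelPairingsFibreEquiv κ q), Nat.card_pi]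

lemma card_labelPairings_const_some {E K : Type*} [Finite E] (k : K) :
    Nat.card (labelPairings fun _ : E => some k) = matchingNumber (Nat.card E) := by
  rw [← card_involutive_fixedPointFree]
  exact Nat.card_congr (Equiv.subtypeEquivRight fun φ => by simp [labelPairings])

lemma card_labelPairings_const_none {E K : Type*} :
    Nat.card (labelPairings fun _ : E => (none : Option K)) = 1 := by
  rw [Nat.card_eq_one_iff_unique]
  refine ⟨⟨fun φ ψ => ?_⟩, ⟨⟨id, fun _ => rfl, by simp⟩⟩⟩
  ext e
  rw [(φ.2.2.1 e).2 rfl, (ψ.2.2.1 e).2 rfl]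

/-- A pairing acts separately on each fibre of `κ`; on the fibre of `none` it is the identity,
whence the factor `1`. -/
lemma card_labelPairings {E K : Type*} [Finite E] (κ : E → Option K) [Fintype (Set.range κ)] :
    Nat.card (labelPairings κ) = ∏ b : Set.range κ,
      b.1.elim 1 fun _ => matchingNumber (Nat.card {e // Set.rangeFactorization κ e = b}) := by
  have h := card_labelPairings_fibres κ (Set.rangeFactorization κ)
  have h2 : ∀ φ, (φ ∈ labelPairings κ ∧ ∀ e, Set.rangeFactorization κ (φ e) =
      Set.rangeFactorization κ e) ↔ φ ∈ labelPairings κ := fun φ =>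
    ⟨fun h => h.1, fun h => ⟨h, fun e => Subtype.ext (h.2.2 e)⟩⟩
  rw [Nat.card_congr (Equiv.subtypeEquivRight h2)] at h
  refine h.trans (Finset.prod_congr rfl fun b _ => ?_)
  obtain ⟨b, hb⟩ := b
  have h3 : (fun e : {e // Set.rangeFactorization κ e = ⟨b, hb⟩} => κ e) = fun _ => b :=
    funext fun e => congrArg Subtype.val e.2
  rw [h3]
  cases b with
  | none => exact card_labelPairings_const_none
  | some k => exact card_labelPairings_const_some k

/-! ### Random variables with moments of all orders -/

/-- The real random variable `f` has finite absolute moments of all orders. -/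
def HasAllMoments {Ω : Type*} [MeasurableSpace Ω] (f : Ω → ℝ) (P : Measure Ω) : Prop :=
  ∀ p : ENNReal, p ≠ ⊤ → MemLp f p P

namespace HasAllMoments

variable {Ω : Type*} [MeasurableSpace Ω] {P : Measure Ω} {f g : Ω → ℝ}

lemma integrable (hf : HasAllMoments f P) : Integrable f P :=
  memLp_one_iff_integrable.1 (hf 1 (by simp))

lemma aemeasurable (hf : HasAllMoments f P) : AEMeasurable f P :=
  hf.integrable.aestronglyMeasurable.aemeasurable

lemma const [IsFiniteMeasure P] (c : ℝ) : HasAllMoments (fun _ => c) P :=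
  fun _ _ => memLp_const c

lemma sub (hf : HasAllMoments f P) (hg : HasAllMoments g P) :
    HasAllMoments (fun ω => f ω - g ω) P :=
  fun p hp => (hf p hp).sub (hg p hp)

lemma mul (hf : HasAllMoments f P) (hg : HasAllMoments g P) :
    HasAllMoments (fun ω => f ω * g ω) P := fun p hp => by
  have : ENNReal.HolderTriple (2 * p) (2 * p) p := ⟨by
    rw [ENNReal.mul_inv (by simp) (by simp), ← add_mul, ENNReal.inv_two_add_inv_two, one_mul]⟩
  have h2 : 2 * p ≠ ⊤ := ENNReal.mul_ne_top (by simp) hp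
  exact (hg _ h2).mul' (hf _ h2)

lemma const_mul (c : ℝ) (hf : HasAllMoments f P) : HasAllMoments (fun ω => c * f ω) P :=
  fun p hp => (hf p hp).const_mul c

lemma sum {ι : Type*} {s : Finset ι} {f : ι → Ω → ℝ} (hf : ∀ i ∈ s, HasAllMoments (f i) P) :
    HasAllMoments (fun ω => ∑ i ∈ s, f i ω) P :=
  fun p hp => memLp_finsetSum s fun i hi => hf i hi p hp

lemma prod [IsFiniteMeasure P] {ι : Type*} {s : Finset ι} {f : ι → Ω → ℝ}
    (hf : ∀ i ∈ s, HasAllMoments (f i) P) : HasAllMoments (fun ω => ∏ i ∈ s, f i ω) P := by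
  classical
  induction s using Finset.induction_on with
  | empty => simpa using const 1
  | insert a s ha ih =>
    simp only [Finset.prod_insert ha]
    exact (hf a (by simp)).mul (ih fun i hi => hf i (by simp [hi]))

lemma pow [IsFiniteMeasure P] (hf : HasAllMoments f P) (n : ℕ) :
    HasAllMoments (fun ω => f ω ^ n) P := by
  simpa using prod (s := Finset.range n) (f := fun _ => f) fun _ _ => hf

end HasAllMoments

/-! ### Wick's formula -/

/-- A family of independent standard Gaussian random variables. -/
structure IsStdGaussianFamily {Ω K : Type*} [MeasurableSpace Ω] (x : K → Ω → ℝ)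
    (P : Measure Ω) : Prop where
  hasLaw : ∀ k, HasLaw (x k) (gaussianReal 0 1) P
  indep : iIndepFun x P

/-- The extension of a family of random variables by the constant `1`. -/
def withOne {Ω K : Type*} (x : K → Ω → ℝ) (o : Option K) (ω : Ω) : ℝ := o.elim 1 fun k => x k ω

namespace IsStdGaussianFamily

variable {Ω K E : Type*} [MeasurableSpace Ω] {P : Measure Ω} [IsProbabilityMeasure P]
  {x : K → Ω → ℝ}

lemma hasAllMoments (hx : IsStdGaussianFamily x P) (k : K) : HasAllMoments (x k) P :=
  fun p hp => by
    have h := memLp_id_gaussianReal' (μ := 0) (v := 1) p hp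
    rw [← (hx.hasLaw k).map_eq] at h
    exact h.comp_of_map (hx.hasLaw k).aemeasurable

lemma hasAllMoments_withOne (hx : IsStdGaussianFamily x P) (o : Option K) :
    HasAllMoments (withOne x o) P := by
  cases o with
  | none => exact HasAllMoments.const 1
  | some k => exact hx.hasAllMoments k

lemma integral_pow (hx : IsStdGaussianFamily x P) (k : K) (n : ℕ) :
    ∫ ω, x k ω ^ n ∂P = matchingNumber n := by
  rw [← integral_pow_gaussianReal_one]
  exact (hx.hasLaw k).integral_comp (f := fun y => y ^ n) (by fun_prop)

/-- Wick's formula. -/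
theorem integral_prod [Fintype E] (hx : IsStdGaussianFamily x P) (κ : E → Option K) :
    ∫ ω, ∏ e, withOne x (κ e) ω ∂P = Nat.card (labelPairings κ) := by
  classical
  let n : K → ℕ := fun k => (Finset.univ.filter fun e => κ e = some k).card
  -- Both sides factor over the labels that occur, by independence on one side and by fibres on the
  -- other; `none` contributes `1` to each.
  let S : Finset K := Finset.eraseNone (Finset.univ.image κ)
  have h1 : ∀ ω, ∏ e, withOne x (κ e) ω = ∏ k : S, x k ω ^ n k := fun ω => by
    rw [Finset.prod_coe_sort S fun k => x k ω ^ n k, Finset.prod_eraseNone]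
    rw [Finset.prod_comp (fun o => withOne x o ω) κ]
    refine Finset.prod_congr rfl fun o _ => ?_
    cases o <;> simp [withOne, n]
  have h2 : Nat.card (labelPairings κ) = ∏ k : S, matchingNumber (n k) := by
    rw [card_labelPairings, Finset.prod_coe_sort S fun k => matchingNumber (n k),
      Finset.prod_eraseNone]
    rw [← Finset.prod_coe_sort (Finset.univ.image κ)]
    refine Fintype.prod_equiv (Equiv.subtypeEquivRight fun o => by simp) _ _ fun o => ?_
    obtain ⟨o, ho⟩ := o
    cases o with
    | none => simp
    | some k =>
      simp only [Equiv.subtypeEquivRight, Option.elim, n]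
      congr 1
      rw [Nat.card_eq_fintype_card, Fintype.card_subtype]
      congr 1
      ext e
      simp [Set.rangeFactorization, Subtype.ext_iff]
  have h3 := (hx.indep.precomp (g := fun k : S => (k : K)) Subtype.val_injective)
  have h4 := h3.integral_fun_prod_comp (X := fun (k : S) => x k)
    (f := fun k y => y ^ n k) (μ := P)
    (fun k => (hx.hasLaw k).aemeasurable) (fun k => by fun_prop)
  simp_rw [h1, h2]
  rw [h4]
  push_cast
  exact Finset.prod_congr rfl fun k _ => hx.integral_pow k _

lemma integral_prod_filter [Fintype E] (hx : IsStdGaussianFamily x P) (κ : E → Option K)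
    (r : E → Prop) [DecidablePred r] :
    ∫ ω, ∏ e with r e, withOne x (κ e) ω ∂P =
      Nat.card (labelPairings fun e : {e // r e} => κ e) := by
  rw [← hx.integral_prod]
  congr! 2 with ω
  exact Finset.prod_subtype _ (by simp) _

end IsStdGaussianFamily

/-! ### Wick's formula for products of centred monomials -/

/-- The product of the variables labelled by the fibre of `p` over `j`. -/
def fibreMonomial {Ω K E J : Type*} [Fintype E] [DecidableEq J] (x : K → Ω → ℝ)
    (κ : E → Option K) (p : E → J) (j : J) (ω : Ω) : ℝ :=
  ∏ e with p e = j, withOne x (κ e) ω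

/-- The pairing `φ` maps no fibre of `p` to itself. -/
def PreservesNoFibre {E J : Type*} (p : E → J) (φ : E → E) : Prop :=
  ∀ j, ∃ e, p e = j ∧ p (φ e) ≠ j

lemma card_labelPairings_congr {E K : Type*} (κ : E → Option K) {r s : E → Prop}
    (h : ∀ e, r e ↔ s e) : Nat.card (labelPairings fun e : {e // r e} => κ e) =
      Nat.card (labelPairings fun e : {e // s e} => κ e) := by
  obtain rfl : r = s := funext fun e => propext (h e)
  rfl

lemma card_labelPairings_of_isEmpty {E K : Type*} [IsEmpty E] (κ : E → Option K) :
    Nat.card (labelPairings κ) = 1 := by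
  rw [Subsingleton.elim κ fun _ => none]
  exact card_labelPairings_const_none

section Centred

variable {Ω K E J : Type*} [MeasurableSpace Ω] {P : Measure Ω} [IsProbabilityMeasure P]
  {x : K → Ω → ℝ} [Fintype E] [Fintype J] [DecidableEq J]

lemma IsStdGaussianFamily.hasAllMoments_fibreMonomial (hx : IsStdGaussianFamily x P)
    (κ : E → Option K) (p : E → J) (j : J) : HasAllMoments (fibreMonomial x κ p j) P :=
  HasAllMoments.prod fun e _ => hx.hasAllMoments_withOne (κ e)

lemma prod_fibreMonomial (κ : E → Option K) (p : E → J) (U : Finset J) (ω : Ω) :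
    ∏ j ∈ U, fibreMonomial x κ p j ω = ∏ e with p e ∈ U, withOne x (κ e) ω := by
  rw [← Finset.prod_fiberwise_of_maps_to (s := Finset.univ.filter fun e => p e ∈ U) (t := U)
    (g := p) (by simp)]
  refine Finset.prod_congr rfl fun j hj => ?_
  rw [fibreMonomial, Finset.filter_filter]
  refine Finset.prod_congr (Finset.filter_congr fun e _ => ?_) fun _ _ => rfl
  constructor
  · rintro rfl; exact ⟨hj, rfl⟩
  · exact fun h => h.2

/-- All the conditions together say that `φ` preserves the fibres of a single map `q`: the factors
in `U` are merged into two blocks according to `T`, and each factor outside `U` is a block of its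
own. The count then factors over the blocks, and each block is an instance of Wick's formula. -/
lemma IsStdGaussianFamily.card_pairings_blocks (hx : IsStdGaussianFamily x P)
    (κ : E → Option K) (p : E → J) (T U : Finset J) :
    (Nat.card {φ : E → E // φ ∈ labelPairings κ ∧ (∀ e, p (φ e) ∈ T ↔ p e ∈ T) ∧
        ∀ j ∉ U, ∀ e, p e = j → p (φ e) = j} : ℝ) =
      ((∫ ω, ∏ j ∈ U ∩ T, fibreMonomial x κ p j ω ∂P) *
        ∫ ω, ∏ j ∈ U \ T, fibreMonomial x κ p j ω ∂P) *
        ∏ j ∈ Finset.univ \ U, ∫ ω, fibreMonomial x κ p j ω ∂P := by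
  let q : E → Bool ⊕ J := fun e =>
    if p e ∈ U then Sum.inl (decide (p e ∈ T)) else Sum.inr (p e)
  have hq : ∀ φ : E → E, Function.Involutive φ → ((∀ e, q (φ e) = q e) ↔
      (∀ e, p (φ e) ∈ T ↔ p e ∈ T) ∧ ∀ j ∉ U, ∀ e, p e = j → p (φ e) = j) := by
    intro φ hφ
    constructor
    · intro h
      have h2 : ∀ j ∉ U, ∀ e, p e = j → p (φ e) = j := by
        rintro _ hj e rfl
        have := h e
        simp only [q, if_neg hj] at this
        split_ifs at this
        exact Sum.inr_injective this
      refine ⟨fun e => ?_, h2⟩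
      by_cases he : p e ∈ U
      · have := h e
        simp only [q, if_pos he] at this
        split_ifs at this
        simpa using this
      · rw [h2 _ he e rfl]
    · rintro ⟨h1, h2⟩ e
      by_cases he : p e ∈ U
      · have he' : p (φ e) ∈ U := by
          by_contra h
          have := h2 _ h (φ e) rfl
          rw [hφ e] at this
          exact h (this ▸ he)
        simp [q, he, he', h1 e]
      · rw [show q (φ e) = q e by simp only [q, h2 _ he e rfl]]
  have h1 : ∀ φ : E → E, (φ ∈ labelPairings κ ∧ (∀ e, p (φ e) ∈ T ↔ p e ∈ T) ∧
        ∀ j ∉ U, ∀ e, p e = j → p (φ e) = j) ↔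
        (φ ∈ labelPairings κ ∧ ∀ e, q (φ e) = q e) := fun φ =>
    and_congr_right fun h => (hq φ h.1).symm
  rw [Nat.card_congr (Equiv.subtypeEquivRight h1), card_labelPairings_fibres,
    Fintype.prod_sum_type, Fintype.prod_bool]
  push_cast
  congr 1
  · simp_rw [prod_fibreMonomial]
    rw [hx.integral_prod_filter, hx.integral_prod_filter]
    congr 2
    · refine card_labelPairings_congr κ fun e => ?_
      by_cases h : p e ∈ U <;> simp [q, h]
    · refine card_labelPairings_congr κ fun e => ?_
      by_cases h : p e ∈ U <;> simp [q, h]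
  · rw [← Finset.prod_subset (Finset.subset_univ (Finset.univ \ U))]
    · refine Finset.prod_congr rfl fun j hj => ?_
      have hj : j ∉ U := by simpa using hj
      simp_rw [fibreMonomial]
      rw [hx.integral_prod_filter]
      congr 1
      refine card_labelPairings_congr κ fun e => ?_
      by_cases h : p e ∈ U
      · simp only [q, h, if_true]
        simp only [reduceCtorEq, false_iff]
        rintro rfl
        exact hj h
      · simp [q, h]
    · intro j _ hj
      have hj : j ∈ U := by simpa using hj
      have : IsEmpty {e // q e = Sum.inr j} := ⟨fun e => by
        have := e.2
        simp only [q] at this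
        split_ifs at this with h
        rw [Sum.inr_injective this] at h
        exact h hj⟩
      rw [card_labelPairings_of_isEmpty, Nat.cast_one]

/-- The expectation of a product of centred monomials counts the pairings for which no factor is
paired within itself. For the product over two independent copies one counts the pairings that,
moreover, preserve the two blocks. -/
theorem IsStdGaussianFamily.integral_prod_centred (hx : IsStdGaussianFamily x P)
    (κ : E → Option K) (p : E → J) (T : Finset J) :
    (∫ ω, ∏ j ∈ T, (fibreMonomial x κ p j ω - ∫ ω', fibreMonomial x κ p j ω' ∂P) ∂P) *
      (∫ ω, ∏ j ∈ Tᶜ, (fibreMonomial x κ p j ω - ∫ ω', fibreMonomial x κ p j ω' ∂P) ∂P) =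
      Nat.card {φ : E → E // φ ∈ labelPairings κ ∧ (∀ e, p (φ e) ∈ T ↔ p e ∈ T) ∧
        PreservesNoFibre p φ} := by
  classical
  set c : J → ℝ := fun j => ∫ ω', fibreMonomial x κ p j ω' ∂P
  -- Factors in `T` live on the first copy of `Ω`, the others on the second, so the product of two
  -- expectations becomes one expectation.
  let b : J → Ω × Ω → ℝ := fun j z =>
    if j ∈ T then fibreMonomial x κ p j z.1 else fibreMonomial x κ p j z.2
  have hb : ∀ (U : Finset J) z, ∏ j ∈ U, b j z =
      (∏ j ∈ U ∩ T, fibreMonomial x κ p j z.1) * ∏ j ∈ U \ T, fibreMonomial x κ p j z.2 := by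
    intro U z
    simp only [b, Finset.prod_ite, Finset.filter_mem_eq_inter]
    congr 2
    ext; simp
  have hm := hx.hasAllMoments_fibreMonomial κ p
  have h1 : (∫ ω, ∏ j ∈ T, (fibreMonomial x κ p j ω - c j) ∂P) *
      (∫ ω, ∏ j ∈ Tᶜ, (fibreMonomial x κ p j ω - c j) ∂P) =
      ∫ z, ∏ j, (b j z + -c j) ∂(P.prod P) := by
    rw [← integral_prod_mul]
    congr! 2 with z
    rw [← Finset.prod_mul_prod_compl T]
    congr 1
    · exact Finset.prod_congr rfl fun j hj => by simp [b, hj, sub_eq_add_neg]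
    · refine Finset.prod_congr rfl fun j hj => ?_
      have hj : j ∉ T := by simpa using hj
      simp [b, hj, sub_eq_add_neg]
  -- Here `U` is the set of factors from which the monomial, rather than its mean, is selected.
  have h2 : ∫ z, ∏ j, (b j z + -c j) ∂(P.prod P) =
      ∑ U ∈ Finset.univ.powerset, (∏ j ∈ Finset.univ \ U, (-1 : ℝ)) *
        (((∫ ω, ∏ j ∈ U ∩ T, fibreMonomial x κ p j ω ∂P) *
        ∫ ω, ∏ j ∈ U \ T, fibreMonomial x κ p j ω ∂P) *
        ∏ j ∈ Finset.univ \ U, c j) := by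
    simp_rw [Finset.prod_add, hb]
    rw [integral_finsetSum]
    · refine Finset.sum_congr rfl fun U _ => ?_
      rw [integral_mul_const, integral_prod_mul (fun ω => ∏ j ∈ U ∩ T, fibreMonomial x κ p j ω)
        fun ω => ∏ j ∈ U \ T, fibreMonomial x κ p j ω]
      simp_rw [← neg_one_mul (c _), Finset.prod_mul_distrib]
      ring
    · intro U _
      exact (Integrable.mul_prod (HasAllMoments.prod fun j _ => hm j).integrable
        (HasAllMoments.prod fun j _ => hm j).integrable).mul_const _
  rw [h1, h2]
  let Φ : Finset (E → E) := Finset.univ.filter fun φ => φ ∈ labelPairings κ ∧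
    ∀ e, p (φ e) ∈ T ↔ p e ∈ T
  have h3 : ∀ U : Finset J, ((∫ ω, ∏ j ∈ U ∩ T, fibreMonomial x κ p j ω ∂P) *
        ∫ ω, ∏ j ∈ U \ T, fibreMonomial x κ p j ω ∂P) * ∏ j ∈ Finset.univ \ U, c j =
      ∑ φ ∈ Φ, ∏ j ∈ Finset.univ \ U, if ∀ e, p e = j → p (φ e) = j then (1 : ℝ) else 0 := by
    intro U
    rw [← hx.card_pairings_blocks κ p T U, Nat.card_eq_fintype_card, Fintype.card_subtype]
    simp_rw [Finset.prod_ite_zero, Finset.prod_const_one]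
    rw [Finset.sum_boole, Finset.filter_filter]
    congr 2
    ext φ
    simp [and_assoc]
  -- Inclusion-exclusion: the indicator of `PreservesNoFibre` is a product of terms `1 - 1[fibre j
  -- preserved]`, whose expansion matches that of the expectation term by term.
  have h4 : (Nat.card {φ : E → E // φ ∈ labelPairings κ ∧ (∀ e, p (φ e) ∈ T ↔ p e ∈ T) ∧
        PreservesNoFibre p φ} : ℝ) =
      ∑ φ ∈ Φ, ∏ j, ((1 : ℝ) + -if ∀ e, p e = j → p (φ e) = j then (1 : ℝ) else 0) := by
    have h5 : ∀ φ : E → E, ∏ j : J, ((1 : ℝ) + -if ∀ e, p e = j → p (φ e) = j then (1 : ℝ) else 0) =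
        if PreservesNoFibre p φ then 1 else 0 := by
      intro φ
      by_cases h : PreservesNoFibre p φ
      · rw [if_pos h]
        refine Finset.prod_eq_one fun j _ => ?_
        obtain ⟨e, h1, h2⟩ := h j
        rw [if_neg fun h3 => h2 (h3 e h1), neg_zero, add_zero]
      · rw [if_neg h]
        simp only [PreservesNoFibre, not_forall, not_exists, not_and, not_not] at h
        obtain ⟨j, hj⟩ := h
        refine Finset.prod_eq_zero (Finset.mem_univ j) ?_
        rw [if_pos hj, add_neg_cancel]
    simp_rw [h5]
    rw [Finset.sum_boole, Finset.filter_filter, Nat.card_eq_fintype_card, Fintype.card_subtype]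
    congr 2
    ext φ
    simp [and_assoc]
  rw [h4]
  simp_rw [h3, Finset.prod_add, Finset.prod_const_one, one_mul, Finset.mul_sum]
  rw [Finset.sum_comm]
  refine Finset.sum_congr rfl fun φ _ => Finset.sum_congr rfl fun U _ => ?_
  rw [← Finset.prod_mul_distrib]
  exact Finset.prod_congr rfl fun j _ => neg_one_mul _

end Centred

/-! ### Counting vertices, edges and components -/

/-- A graph with vertex set `V` and edge set `E` has at least `|V| - |E|` components. -/
lemma card_le_card_add_card_quot {V E : Type*} [Finite V] [Finite E] (s t : E → V) :
    Nat.card V ≤ Nat.card E + Nat.card (Quot fun u v => ∃ e, s e = u ∧ t e = v) := by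
  classical
  have := Fintype.ofFinite V
  have := Fintype.ofFinite E
  let r : V → V → Prop := fun u v => ∃ e, s e = u ∧ t e = v
  have := Fintype.ofFinite (Quot r)
  -- The coboundary map: its kernel consists of functions constant on components and its rank is at
  -- most `|E|`, so rank-nullity gives the bound.
  let d : (V → ℝ) →ₗ[ℝ] (E → ℝ) :=
    LinearMap.funLeft ℝ ℝ s - LinearMap.funLeft ℝ ℝ t
  let c : (Quot r → ℝ) →ₗ[ℝ] (V → ℝ) := LinearMap.funLeft ℝ ℝ (Quot.mk r)
  have h1 : LinearMap.ker d ≤ LinearMap.range c := by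
    intro f hf
    refine ⟨Quot.lift f ?_, rfl⟩
    rintro _ _ ⟨e, rfl, rfl⟩
    have := congrFun (LinearMap.mem_ker.1 hf) e
    simpa [d, sub_eq_zero, LinearMap.funLeft_apply] using this
  have h2 := d.finrank_range_add_finrank_ker
  have h3 := Submodule.finrank_mono h1
  have h4 := LinearMap.finrank_range_le c
  have h5 := Submodule.finrank_le (LinearMap.range d)
  simp only [Module.finrank_fintype_fun_eq_card] at h2 h4 h5
  rw [Nat.card_eq_fintype_card, Nat.card_eq_fintype_card, Nat.card_eq_fintype_card]
  change _ ≤ _ + Fintype.card (Quot r)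
  omega

namespace DirectedGraph

/-- There is an edge from `u` to `v`. -/
def EdgeRel (G : DirectedGraph) (u v : G.V) : Prop := ∃ e, G.src e = u ∧ G.tgt e = v

variable (G : DirectedGraph)

lemma reachable_iff {u v : G.V} :
    G.toSimple.Reachable u v ↔ Quot.mk G.EdgeRel u = Quot.mk G.EdgeRel v := by
  constructor
  · rintro ⟨w⟩
    induction w with
    | nil => rfl
    | cons h _ ih =>
      refine Eq.trans ?_ ih
      rw [toSimple, SimpleGraph.fromRel_adj] at h
      exact h.2.elim (fun h => Quot.sound h) fun h => (Quot.sound h).symm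
  · intro h
    have key : ∀ a b, G.EdgeRel a b → G.toSimple.connectedComponentMk a =
        G.toSimple.connectedComponentMk b := by
      intro a b hab
      by_cases hne : a = b
      · rw [hne]
      · exact SimpleGraph.ConnectedComponent.sound
          (SimpleGraph.Adj.reachable ((SimpleGraph.fromRel_adj _ _ _).2 ⟨hne, Or.inl hab⟩))
    exact SimpleGraph.ConnectedComponent.exact (congrArg (Quot.lift _ key) h)

lemma connected_iff :
    G.Connected ↔ (∀ u v, Quot.mk G.EdgeRel u = Quot.mk G.EdgeRel v) ∧ Nonempty G.V := by
  rw [Connected, SimpleGraph.connected_iff]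
  simp only [SimpleGraph.Preconnected, reachable_iff]

/-- For connected graphs `|V| ≤ |simple edges| + 1 ≤ |E| + 1`. Equality throughout says that the
simple graph is a tree and that no edge is lost to a loop or a repetition. -/
lemma isTree_iff : G.IsTree ↔ G.Connected ∧ Nat.card G.V = Nat.card G.E + 1 := by
  classical
  let f : G.E → Sym2 G.V := fun e => s(G.src e, G.tgt e)
  have hmem : ∀ e, G.src e ≠ G.tgt e → f e ∈ G.toSimple.edgeSet := fun e he => by
    rw [SimpleGraph.mem_edgeSet, toSimple, SimpleGraph.fromRel_adj]
    exact ⟨he, Or.inl ⟨e, rfl, rfl⟩⟩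
  have hsub : G.toSimple.edgeSet ⊆ Set.range f := by
    intro z
    induction z with
    | h u v =>
      intro h
      rw [SimpleGraph.mem_edgeSet, toSimple, SimpleGraph.fromRel_adj] at h
      rcases h.2 with ⟨e, rfl, rfl⟩ | ⟨e, rfl, rfl⟩
      · exact ⟨e, rfl⟩
      · exact ⟨e, Sym2.eq_swap⟩
  rw [IsTree, SimpleGraph.isTree_iff_connected_and_card, Connected, and_assoc]
  refine and_congr_right fun hc => ?_
  have hrange : (Set.range f).ncard ≤ Nat.card G.E := by
    rw [← Set.image_univ, ← Set.ncard_univ]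
    exact Set.ncard_image_le
  constructor
  · rintro ⟨h1, h2, h3⟩
    have h4 : G.toSimple.edgeSet = Set.range f :=
      hsub.antisymm (Set.range_subset_iff.2 fun e => hmem e (h2 e))
    rw [← h1, h4, Nat.card_coe_set_eq, Set.ncard_range_of_injective h3]
  · intro h
    have h1 := hc.card_vert_le_card_edgeSet_add_one
    have h2 := Set.ncard_le_ncard hsub
    rw [Nat.card_coe_set_eq] at h1 ⊢
    have h3 : G.toSimple.edgeSet = Set.range f :=
      Set.eq_of_subset_of_ncard_le hsub (by omega)
    refine ⟨by omega, fun e he => ?_, ?_⟩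
    · have h4 : f e ∈ G.toSimple.edgeSet := h3 ▸ ⟨e, rfl⟩
      exact SimpleGraph.not_isDiag_of_mem_edgeSet _ h4 he
    · have h4 : (f '' Set.univ).ncard = (Set.univ : Set G.E).ncard := by
        rw [Set.image_univ, Set.ncard_univ]; omega
      exact Set.injOn_univ.1 (Set.injOn_of_ncard_image_eq h4)

end DirectedGraph

/-- A class `{e, φ e}` has either two elements and no fixed point, or one element, which is fixed.
In both cases the two numbers add up to `2`. -/
lemma two_mul_card_quot_involutive {E : Type*} [Finite E] {φ : E → E}
    (hφ : Function.Involutive φ) :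
    2 * Nat.card (Quot fun e e' : E => e' = φ e) = Nat.card E + {e | φ e = e}.ncard := by
  classical
  have := Fintype.ofFinite E
  let r : E → E → Prop := fun e e' => e' = φ e
  have := Fintype.ofFinite (Quot r)
  have hr : ∀ a b, Quot.mk r a = Quot.mk r b ↔ a = b ∨ a = φ b := by
    refine fun a b => ⟨fun h => ?_, ?_⟩
    · rw [Quot.eq] at h
      induction h with
      | rel x y h => exact Or.inr (by rw [show y = φ x from h, hφ x])
      | refl x => exact Or.inl rfl
      | symm x y _ ih =>
        rcases ih with rfl | rfl
        · exact Or.inl rfl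
        · exact Or.inr (hφ y).symm
      | trans x y z _ _ h1 h2 =>
        rcases h1 with rfl | rfl <;> rcases h2 with rfl | rfl <;> simp [hφ _]
    · rintro (rfl | rfl)
      · rfl
      · exact (Quot.sound (r := r) rfl).symm
  have h1 : Nat.card E = ∑ q : Quot r, (Finset.univ.filter fun e => Quot.mk r e = q).card := by
    rw [Nat.card_eq_fintype_card, ← Finset.card_univ]
    exact Finset.card_eq_sum_card_fiberwise fun _ _ => Finset.mem_coe.2 (Finset.mem_univ _)
  have h2 : {e | φ e = e}.ncard = ∑ q : Quot r,
      ((Finset.univ.filter fun e => φ e = e).filter fun e => Quot.mk r e = q).card := by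
    rw [Set.ncard_eq_toFinset_card', show {e | φ e = e}.toFinset =
      Finset.univ.filter fun e => φ e = e from by ext; simp]
    exact Finset.card_eq_sum_card_fiberwise fun _ _ => Finset.mem_coe.2 (Finset.mem_univ _)
  rw [h1, h2, ← Finset.sum_add_distrib, Nat.card_eq_fintype_card, ← Finset.card_univ, mul_comm,
    ← smul_eq_mul, ← Finset.sum_const]
  refine Finset.sum_congr rfl fun q _ => ?_
  obtain ⟨a, rfl⟩ : ∃ a, Quot.mk r a = q := Quot.exists_rep q
  simp_rw [hr]
  have h3 : (Finset.univ.filter fun e => e = a ∨ e = φ a) = {a, φ a} := by ext; simp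
  by_cases ha : φ a = a
  · have h4 : ((Finset.univ.filter fun e => φ e = e).filter fun e => e = a ∨ e = φ a) = {a} := by
      ext e
      simp only [Finset.mem_filter, Finset.mem_univ, true_and, Finset.mem_singleton, ha, or_self]
      exact ⟨fun h => h.2, fun h => ⟨h ▸ ha, h⟩⟩
    rw [h3, h4, ha]; simp
  · have h4 : ((Finset.univ.filter fun e => φ e = e).filter fun e => e = a ∨ e = φ a) = ∅ := by
      ext e
      simp only [Finset.mem_filter, Finset.mem_univ, true_and, Finset.notMem_empty, iff_false,
        not_and, not_or]
      intro he
      refine ⟨fun h => ha (h ▸ he), ?_⟩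
      rintro rfl
      rw [hφ a] at he
      exact ha he.symm
    rw [h3, h4, Finset.card_pair (Ne.symm ha)]; simp

namespace DirectedGraph

variable {G H : DirectedGraph}

lemma quot_mk_eq_map (f : G.V → H.V)
    (hf : ∀ e, Quot.mk H.EdgeRel (f (G.src e)) = Quot.mk H.EdgeRel (f (G.tgt e))) {u v : G.V}
    (h : Quot.mk G.EdgeRel u = Quot.mk G.EdgeRel v) :
    Quot.mk H.EdgeRel (f u) = Quot.mk H.EdgeRel (f v) := by
  refine congrArg (Quot.lift (fun u => Quot.mk H.EdgeRel (f u)) ?_) h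
  rintro _ _ ⟨e, rfl, rfl⟩
  exact hf e

lemma Connected.map (hG : G.Connected) (f : G.V → H.V) (hs : Function.Surjective f)
    (hf : ∀ e, Quot.mk H.EdgeRel (f (G.src e)) = Quot.mk H.EdgeRel (f (G.tgt e))) :
    H.Connected := by
  rw [connected_iff] at hG ⊢
  obtain ⟨h, ⟨v⟩⟩ := hG
  refine ⟨fun a b => ?_, ⟨f v⟩⟩
  obtain ⟨a, rfl⟩ := hs a
  obtain ⟨b, rfl⟩ := hs b
  exact quot_mk_eq_map f hf (h a b)

lemma isTree_congr (fV : G.V ≃ H.V) (fE : G.E ≃ H.E) (hs : ∀ e, H.src (fE e) = fV (G.src e))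
    (ht : ∀ e, H.tgt (fE e) = fV (G.tgt e)) : G.IsTree ↔ H.IsTree := by
  rw [isTree_iff, isTree_iff, Nat.card_congr fV, Nat.card_congr fE]
  refine and_congr_left fun _ => ⟨fun h => ?_, fun h => ?_⟩
  · exact h.map fV fV.surjective fun e => Quot.sound ⟨fE e, hs e, ht e⟩
  · refine h.map fV.symm fV.symm.surjective fun e => Quot.sound ⟨fE.symm e, ?_, ?_⟩
    · rw [Equiv.eq_symm_apply, ← hs, Equiv.apply_symm_apply]
    · rw [Equiv.eq_symm_apply, ← ht, Equiv.apply_symm_apply]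

/-- Removes the induced subgraph from the definitions of atomic and bi-atomic pairings when the
component, or the union of two, is the whole graph. -/
lemma isTree_identify_restrict {φ : G.E → G.E} {S : Set G.V} (h : G.PreservesEdgesOf φ S)
    (hS : S = Set.univ) :
    ((G.restrict S).identify (G.restrictEdgeMap h)).IsTree ↔ (G.identify φ).IsTree := by
  subst hS
  let e0 : (G.restrict Set.univ).E ≃ G.E := Equiv.subtypeUnivEquiv fun _ => ⟨trivial, trivial⟩
  refine isTree_congr (Quot.congr (Equiv.subtypeUnivEquiv fun _ => trivial) fun a b => ?_)
    (Quot.congr e0 fun a b => Subtype.ext_iff) ?_ ?_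
  · constructor
    · rintro ⟨e, ⟨rfl, rfl⟩ | ⟨rfl, rfl⟩⟩
      · exact ⟨e.1, Or.inl ⟨rfl, rfl⟩⟩
      · exact ⟨e.1, Or.inr ⟨rfl, rfl⟩⟩
    · rintro ⟨e, ⟨h1, h2⟩ | ⟨h1, h2⟩⟩
      · exact ⟨e0.symm e, Or.inl ⟨Subtype.ext h1, Subtype.ext h2⟩⟩
      · exact ⟨e0.symm e, Or.inr ⟨Subtype.ext h1, Subtype.ext h2⟩⟩
  · rintro ⟨e⟩; rfl
  · rintro ⟨e⟩; rfl

/-- The component of the image of a vertex in the graph `G.identify φ`. -/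
def componentMk (G : DirectedGraph) (φ : G.E → G.E) (v : G.V) : Quot (G.identify φ).EdgeRel :=
  Quot.mk _ (Quot.mk _ v)

lemma componentMk_edge (φ : G.E → G.E) (e : G.E) :
    G.componentMk φ (G.src e) = G.componentMk φ (G.tgt e) :=
  Quot.sound ⟨Quot.mk _ e, rfl, rfl⟩

lemma componentMk_src (φ : G.E → G.E) (e : G.E) :
    G.componentMk φ (G.src e) = G.componentMk φ (G.src (φ e)) :=
  congrArg (Quot.mk _) (Quot.sound ⟨e, Or.inl ⟨rfl, rfl⟩⟩)

lemma componentMk_eq (φ : G.E → G.E) {u v : G.V}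
    (h : Quot.mk G.EdgeRel u = Quot.mk G.EdgeRel v) : G.componentMk φ u = G.componentMk φ v :=
  quot_mk_eq_map (H := G.identify φ) (Quot.mk _) (componentMk_edge φ) h

lemma componentMk_surjective (φ : G.E → G.E) : Function.Surjective (G.componentMk φ) := by
  rintro ⟨⟨v⟩⟩
  exact ⟨v, rfl⟩

lemma Connected.identify (hG : G.Connected) (φ : G.E → G.E) : (G.identify φ).Connected :=
  hG.map (Quot.mk _) Quot.mk_surjective (componentMk_edge φ)

/-- If no fibre of `p` is preserved by `φ`, then `G.identify φ` has at most half as many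
components as `p` has fibres, and if there are that many, the fibres are matched by `φ`. -/
lemma card_identify_le {J : Type*} [Fintype J] (p : G.V → J)
    (hsurj : Function.Surjective p)
    (hconn : ∀ u v, p u = p v → Quot.mk G.EdgeRel u = Quot.mk G.EdgeRel v) {φ : G.E → G.E}
    (hno : PreservesNoFibre (fun e => p (G.src e)) φ) :
    2 * Nat.card (G.identify φ).V ≤ 2 * Nat.card (G.identify φ).E + Fintype.card J ∧
      (2 * Nat.card (G.identify φ).V = 2 * Nat.card (G.identify φ).E + Fintype.card J →
        ∀ a, ∃ b ≠ a, ∀ e, (p (G.src (φ e)) = a ∨ p (G.src (φ e)) = b) ↔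
          (p (G.src e) = a ∨ p (G.src e) = b)) := by
  classical
  -- The fibres are connected, so the classes of `R` on `J` map onto the components of the glued
  -- graph. Every class has at least two elements because no fibre is preserved.
  let R : J → J → Prop := fun j j' => ∃ e, p (G.src e) = j ∧ p (G.src (φ e)) = j'
  have := Fintype.ofFinite (Quot R)
  have hRe : ∀ e, Quot.mk R (p (G.src e)) = Quot.mk R (p (G.src (φ e))) := fun e =>
    Quot.sound ⟨e, rfl, rfl⟩
  choose g hg using hsurj
  have h1 := card_le_card_add_card_quot (G.identify φ).src (G.identify φ).tgt
  have h2 : Nat.card (Quot (G.identify φ).EdgeRel) ≤ Nat.card (Quot R) := by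
    refine Nat.card_le_card_of_surjective (Quot.lift (fun j => G.componentMk φ (g j)) ?_) ?_
    · rintro _ _ ⟨e, rfl, rfl⟩
      rw [componentMk_eq φ (hconn _ (G.src e) (hg _)),
        componentMk_eq φ (hconn _ (G.src (φ e)) (hg _)), componentMk_src]
    · intro c
      obtain ⟨v, rfl⟩ := componentMk_surjective φ c
      exact ⟨Quot.mk _ (p v), componentMk_eq φ (hconn _ _ (hg _))⟩
  have h3 : Fintype.card J = ∑ q : Quot R, (Finset.univ.filter fun j => Quot.mk R j = q).card := by
    rw [← Finset.card_univ]
    exact Finset.card_eq_sum_card_fiberwise fun _ _ => Finset.mem_coe.2 (Finset.mem_univ _)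
  have h4 : ∀ q ∈ (Finset.univ : Finset (Quot R)),
      2 ≤ (Finset.univ.filter fun j => Quot.mk R j = q).card := by
    rintro ⟨j⟩ _
    obtain ⟨e, rfl, he⟩ := hno j
    exact Finset.one_lt_card.2 ⟨p (G.src e), by simp, p (G.src (φ e)), by simp [hRe e], Ne.symm he⟩
  have h5 : 2 * Nat.card (Quot R) = ∑ q : Quot R, 2 := by
    rw [Finset.sum_const, Nat.card_eq_fintype_card, Finset.card_univ, smul_eq_mul, mul_comm]
  have h6 := Finset.sum_le_sum h4
  change _ ≤ _ + Nat.card (Quot (G.identify φ).EdgeRel) at h1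
  refine ⟨by omega, fun heq a => ?_⟩
  -- Equality in the bound forces every class to have exactly two elements; the class of `a` is then
  -- `{a, b}`.
  have h7 := (Finset.sum_eq_sum_iff_of_le h4).1 (by omega) (Quot.mk R a) (Finset.mem_univ _)
  obtain ⟨x, y, hxy, hS⟩ := Finset.card_eq_two.1 h7.symm
  have hmem : ∀ j, Quot.mk R j = Quot.mk R a ↔ j = x ∨ j = y := fun j => by
    have := Finset.ext_iff.1 hS j
    simpa using this
  obtain ⟨b, hba, hb⟩ : ∃ b ≠ a, ∀ j, Quot.mk R j = Quot.mk R a ↔ j = a ∨ j = b := by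
    rcases (hmem a).1 rfl with rfl | rfl
    · exact ⟨y, hxy.symm, hmem⟩
    · exact ⟨x, hxy, fun j => (hmem j).trans or_comm⟩
  exact ⟨b, hba, fun e => by rw [← hb, ← hb, hRe e]⟩

end DirectedGraph

/-! ### Atomic and bi-atomic pairings characterised by vertex counts -/

namespace LabelledGraph

variable {G H : LabelledGraph}

/-- The fixed points of `φ` are the deterministic edges and the other classes have two elements.
Only the number of vertices of the glued graph thus depends on the pairing. -/
lemma edgeExponent_eq {φ : G.E → G.E} (hφ : φ ∈ G.pairings) :
    G.edgeExponent = Nat.card (G.identify φ).E := by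
  have h1 := two_mul_card_quot_involutive hφ.1
  have h2 : {e | φ e = e} = {e : G.E | G.label e = none} := Set.ext hφ.2.1
  have h3 := Set.ncard_add_ncard_compl {e : G.E | G.label e = none}
  have h4 : {e : G.E | G.label e = none}ᶜ = {e : G.E | G.label e ≠ none} := rfl
  rw [h2, ← h3, h4] at h1
  change 2 * Nat.card (G.identify φ).E = _ at h1
  rw [edgeExponent]
  have h5 := congrArg (Nat.cast (R := ℝ)) h1
  push_cast at h5
  linarith

/-- Gluing preserves connectedness, so being a tree reduces to the vertex count. -/
lemma mem_atomicPairings_iff (hG : G.Connected) {φ : G.E → G.E} :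
    φ ∈ G.atomicPairings ↔ φ ∈ G.pairings ∧ (Nat.card (G.identify φ).V : ℝ) = G.edgeExponent + 1 := by
  refine and_congr_right fun hφ => ?_
  have hS : ∀ c : G.toSimple.ConnectedComponent, c.supp = Set.univ := fun c => by
    induction c using SimpleGraph.ConnectedComponent.ind with
    | h v =>
      ext w
      simpa using hG.preconnected w v
  have h1 : (G.identify φ).IsTree ↔ (Nat.card (G.identify φ).V : ℝ) = G.edgeExponent + 1 := by
    rw [DirectedGraph.isTree_iff, edgeExponent_eq hφ]
    exact ⟨fun h => mod_cast h.2, fun h => ⟨DirectedGraph.Connected.identify hG φ, mod_cast h⟩⟩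
  rw [← h1]
  constructor
  · intro h
    obtain ⟨v⟩ := hG.nonempty
    obtain ⟨h2, h3⟩ := h (G.toSimple.connectedComponentMk v)
    exact (DirectedGraph.isTree_identify_restrict h2 (hS _)).1 h3
  · intro h c
    have h2 : G.PreservesEdgesOf φ c.supp := fun e _ => by rw [hS]; exact ⟨trivial, trivial⟩
    exact ⟨h2, (DirectedGraph.isTree_identify_restrict h2 (hS _)).2 h⟩

/-- The bi-atomic pairings of a graph with two components, which are the fibres of `s`. -/
lemma mem_biatomicPairings_iff_of_fibres (D : LabelledGraph) (s : D.V → Bool)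
    (hsurj : Function.Surjective s) (hst : ∀ e, s (D.src e) = s (D.tgt e))
    (hconn : ∀ u v, s u = s v → Quot.mk D.EdgeRel u = Quot.mk D.EdgeRel v) {φ : D.E → D.E} :
    φ ∈ D.biatomicPairings ↔ φ ∈ D.pairings ∧ PreservesNoFibre (fun e => s (D.src e)) φ ∧
      (Nat.card (D.identify φ).V : ℝ) = D.edgeExponent + 1 := by
  refine and_congr_right fun hφ => ?_
  obtain ⟨v0, hv0⟩ := hsurj true
  obtain ⟨w0, hw0⟩ := hsurj false
  have hcomp : ∀ u v : D.V, D.toSimple.connectedComponentMk u = D.toSimple.connectedComponentMk v ↔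
      s u = s v := fun u v => by
    rw [SimpleGraph.ConnectedComponent.eq, DirectedGraph.reachable_iff]
    refine ⟨fun h => congrArg (Quot.lift s ?_) h, hconn u v⟩
    rintro _ _ ⟨e, rfl, rfl⟩
    exact hst e
  have hS : ∀ c c' : D.toSimple.ConnectedComponent, c' ≠ c → c.supp ∪ c'.supp = Set.univ := by
    intro c c' hne
    induction c using SimpleGraph.ConnectedComponent.ind with
    | h u =>
      induction c' using SimpleGraph.ConnectedComponent.ind with
      | h v =>
        rw [Ne, hcomp] at hne
        ext w
        simp only [Set.mem_union, SimpleGraph.ConnectedComponent.mem_supp_iff, hcomp, Set.mem_univ,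
          iff_true]
        revert hne
        cases s u <;> cases s v <;> cases s w <;> simp
  have hother : ∀ c : D.toSimple.ConnectedComponent, ∃ c', c' ≠ c := by
    intro c
    induction c using SimpleGraph.ConnectedComponent.ind with
    | h u =>
      obtain ⟨v, hv⟩ := hsurj (!s u)
      exact ⟨D.toSimple.connectedComponentMk v, by rw [Ne, hcomp, hv]; simp⟩
  have h1 : (D.identify φ).IsTree ↔ PreservesNoFibre (fun e => s (D.src e)) φ ∧
      (Nat.card (D.identify φ).V : ℝ) = D.edgeExponent + 1 := by
    rw [DirectedGraph.isTree_iff, edgeExponent_eq hφ]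
    norm_cast
    -- The vertex count appears on both sides; what remains is that the glued graph is connected iff
    -- neither side is paired within itself.
    refine and_congr_left fun _ => ⟨fun h => ?_, fun h => ?_⟩
    · by_contra hno
      simp only [PreservesNoFibre, not_forall, not_exists, not_and, not_not] at hno
      obtain ⟨j, hj⟩ := hno
      -- As `φ` is an involution, preserving one of two sides means preserving both. Then `s`
      -- descends to the components of the glued graph, which separates `v0` from `w0`.
      have hpres : ∀ e, s (D.src (φ e)) = s (D.src e) := by
        intro e
        by_cases he : s (D.src e) = j
        · rw [hj e he, he]
        · by_cases he' : s (D.src (φ e)) = j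
          · have := hj _ he'
            rw [hφ.1 e] at this
            exact absurd this he
          · revert he he'
            cases j <;> cases s (D.src e) <;> cases s (D.src (φ e)) <;> simp
      let f : (D.identify φ).V → Bool := Quot.lift (s) (by
        rintro _ _ ⟨e, ⟨rfl, rfl⟩ | ⟨rfl, rfl⟩⟩
        · exact (hpres e).symm
        · rw [← hst, ← hst, hpres])
      have h2 := ((DirectedGraph.connected_iff _).1 h).1 (Quot.mk _ v0)
        (Quot.mk _ w0)
      have h3 := congrArg (Quot.lift f (by rintro _ _ ⟨⟨e⟩, rfl, rfl⟩; exact hst e)) h2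
      simp [f, hv0, hw0] at h3
    · rw [DirectedGraph.connected_iff]
      refine ⟨?_, ⟨Quot.mk _ v0⟩⟩
      -- An edge paired across the two sides joins them, each side being connected.
      obtain ⟨e, he, he'⟩ := h true
      have h2 : ∀ v : D.V, D.componentMk φ v = D.componentMk φ (D.src e) := by
        intro v
        by_cases hv : s v = true
        · exact DirectedGraph.componentMk_eq φ
            (hconn _ _ (hv.trans he.symm))
        · rw [DirectedGraph.componentMk_src]
          refine DirectedGraph.componentMk_eq φ (hconn _ _ ?_)
          simp only [Bool.not_eq_true] at hv he'
          rw [hv, he']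
      rintro ⟨u⟩ ⟨v⟩
      exact (h2 u).trans (h2 v).symm
  rw [← h1]
  constructor
  · intro h
    obtain ⟨c', hne, h2, h3⟩ := h (D.toSimple.connectedComponentMk v0)
    exact (DirectedGraph.isTree_identify_restrict h2 (hS _ _ hne)).1 h3
  · intro h c
    obtain ⟨c', hne⟩ := hother c
    have h2 : D.PreservesEdgesOf φ (c.supp ∪ c'.supp) := fun e _ => by
      rw [hS _ _ hne]; exact ⟨trivial, trivial⟩
    exact ⟨c', hne, h2, (DirectedGraph.isTree_identify_restrict h2 (hS _ _ hne)).2 h⟩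

/-- The side of a vertex of a disjoint union: `true` for the first graph. -/
def side (v : (G.disjUnion H).V) : Bool := Sum.isLeft v

lemma side_src (e : (G.disjUnion H).E) :
    side ((G.disjUnion H).src e) = side ((G.disjUnion H).tgt e) := by
  rcases e with e | e <;> rfl

lemma side_surjective (hG : G.Connected) (hH : H.Connected) :
    Function.Surjective (side : (G.disjUnion H).V → Bool) := by
  obtain ⟨v⟩ := hG.nonempty
  obtain ⟨w⟩ := hH.nonempty
  rintro (_ | _)
  · exact ⟨Sum.inr w, rfl⟩
  · exact ⟨Sum.inl v, rfl⟩

lemma side_connected (hG : G.Connected) (hH : H.Connected) :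
    ∀ u v : (G.disjUnion H).V, side u = side v →
      Quot.mk (G.disjUnion H).EdgeRel u = Quot.mk (G.disjUnion H).EdgeRel v := by
  rw [DirectedGraph.connected_iff] at hG hH
  rintro (u | u) (v | v) h
  · exact DirectedGraph.quot_mk_eq_map (H := (G.disjUnion H).toDirectedGraph) Sum.inl
      (fun e => Quot.sound ⟨Sum.inl e, rfl, rfl⟩) (hG.1 u v)
  · simp [side] at h
  · simp [side] at h
  · exact DirectedGraph.quot_mk_eq_map (H := (G.disjUnion H).toDirectedGraph) Sum.inr
      (fun e => Quot.sound ⟨Sum.inr e, rfl, rfl⟩) (hH.1 u v)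

lemma mem_biatomicPairings_iff (hG : G.Connected) (hH : H.Connected)
    {φ : (G.disjUnion H).E → (G.disjUnion H).E} :
    φ ∈ (G.disjUnion H).biatomicPairings ↔ φ ∈ (G.disjUnion H).pairings ∧
      PreservesNoFibre (fun e => side ((G.disjUnion H).src e)) φ ∧
      (Nat.card ((G.disjUnion H).identify φ).V : ℝ) = (G.disjUnion H).edgeExponent + 1 :=
  mem_biatomicPairings_iff_of_fibres _ side (side_surjective hG hH) side_src
    (side_connected hG hH)

end LabelledGraph

/-! ### Joint moments of graph values as sums over pairings -/

/-- Products of sums of random variables, for two independent copies. -/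
lemma integral_prod_sum_mul_integral_prod_sum {Ω J : Type*} [MeasurableSpace Ω] {P : Measure Ω}
    [IsProbabilityMeasure P] [Fintype J] [DecidableEq J] {I : J → Type*} [∀ j, Fintype (I j)]
    (a : (j : J) → I j → Ω → ℝ) (ha : ∀ j i, HasAllMoments (a j i) P) (T : Finset J) :
    (∫ ω, ∏ j ∈ T, ∑ i, a j i ω ∂P) * (∫ ω, ∏ j ∈ Tᶜ, ∑ i, a j i ω ∂P) =
      ∑ i : (j : J) → I j, (∫ ω, ∏ j ∈ T, a j (i j) ω ∂P) * ∫ ω, ∏ j ∈ Tᶜ, a j (i j) ω ∂P := by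
  classical
  let b : (j : J) → I j → Ω × Ω → ℝ := fun j i z => if j ∈ T then a j i z.1 else a j i z.2
  have hT : ∀ (F : J → Ω → ℝ) (z : Ω × Ω), (∏ j ∈ T, F j z.1) * ∏ j ∈ Tᶜ, F j z.2 =
      ∏ j, if j ∈ T then F j z.1 else F j z.2 := by
    intro F z
    rw [← Finset.prod_mul_prod_compl T]
    congr 1
    · exact Finset.prod_congr rfl fun j hj => by simp [hj]
    · refine Finset.prod_congr rfl fun j hj => ?_
      have hj : j ∉ T := by simpa using hj
      simp [hj]
  rw [← integral_prod_mul]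
  simp_rw [← integral_prod_mul]
  rw [← integral_finsetSum]
  · congr! 2 with z
    rw [hT fun j ω => ∑ i, a j i ω]
    have h1 : ∀ j, (if j ∈ T then ∑ i, a j i z.1 else ∑ i, a j i z.2) = ∑ i, b j i z := by
      intro j
      by_cases hj : j ∈ T <;> simp [b, hj]
    simp_rw [h1]
    rw [Finset.prod_univ_sum, Fintype.piFinset_univ]
    exact Finset.sum_congr rfl fun i _ => (hT (fun j => a j (i j)) z).symm
  · intro i _
    exact Integrable.mul_prod (HasAllMoments.prod fun j _ => ha j _).integrable
      (HasAllMoments.prod fun j _ => ha j _).integrable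

lemma fibreMonomial_eq_prod {Ω K E E' J : Type*} [Fintype E] [Fintype E'] [DecidableEq J]
    {x : K → Ω → ℝ} (κ : E → Option K) (p : E → J) (j : J) (g : E' → E)
    (hg : Function.Injective g) (hr : ∀ e, p e = j ↔ ∃ e', g e' = e) (ω : Ω) :
    fibreMonomial x κ p j ω = ∏ e', withOne x (κ (g e')) ω := by
  symm
  refine Finset.prod_bij (fun e _ => g e) (fun e _ => ?_) (fun a _ b _ h => hg h) ?_ fun _ _ => rfl
  · simp [(hr (g e)).2 ⟨e, rfl⟩]
  · intro e he
    obtain ⟨e', rfl⟩ := (hr e).1 (by simpa using he)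
    exact ⟨e', Finset.mem_univ _, rfl⟩

namespace LabelledGraph

/-- The label and the indices of the matrix entry at an edge. -/
def entryLabel (G : LabelledGraph) {N : ℕ} (i : G.V → Fin N) (e : G.E) :
    Option (ℕ × Fin N × Fin N) :=
  (G.label e).map fun ℓ => (ℓ, i (G.src e), i (G.tgt e))

open scoped Classical in
/-- The value of the product graph whose random inputs have the entries `x`. -/
def graphSum (G : LabelledGraph) {Ω : Type*} {N : ℕ} (x : ℕ × Fin N × Fin N → Ω → ℝ) (ω : Ω) : ℝ :=
  ∑ i : G.V → Fin N, ∏ e, withOne x (G.entryLabel i e) ω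

/-- Two edges carry the same matrix entry when their labels agree and the index map agrees at their
sources and at their targets. Deterministic edges are fixed by `φ` and impose no condition on `i`.
-/
lemma mem_labelPairings_entryLabel (G : LabelledGraph) {N : ℕ} (i : G.V → Fin N) (φ : G.E → G.E) :
    φ ∈ labelPairings (G.entryLabel i) ↔
      φ ∈ G.pairings ∧ ∀ u v, G.VertexRel φ u v → i u = i v := by
  have hnone : ∀ e, G.entryLabel i e = none ↔ G.label e = none := by simp [entryLabel]
  constructor
  · rintro ⟨h1, h2, h3⟩
    have h4 : ∀ e, φ e ≠ e → G.label (φ e) = G.label e ∧ i (G.src e) = i (G.src (φ e)) ∧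
        i (G.tgt e) = i (G.tgt (φ e)) := by
      intro e he
      have h5 := h3 e
      rw [Ne, h2, hnone] at he
      obtain ⟨ℓ, hℓ⟩ := Option.ne_none_iff_exists'.1 he
      simp only [entryLabel, hℓ, Option.map_some, Option.map_eq_some_iff, Prod.mk.injEq] at h5
      obtain ⟨ℓ', h6, rfl, h7, h8⟩ := h5
      exact ⟨h6.trans hℓ.symm, h7.symm, h8.symm⟩
    refine ⟨⟨h1, fun e => (h2 e).trans (hnone e), fun e => ?_⟩, ?_⟩
    · by_cases he : φ e = e
      · rw [he]
      · exact (h4 e he).1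
    · rintro _ _ ⟨e, ⟨rfl, rfl⟩ | ⟨rfl, rfl⟩⟩ <;> by_cases he : φ e = e
      · rw [he]
      · exact (h4 e he).2.1
      · rw [he]
      · exact (h4 e he).2.2
  · rintro ⟨⟨h1, h2, h3⟩, h4⟩
    refine ⟨h1, fun e => (h2 e).trans (hnone e).symm, fun e => ?_⟩
    rw [entryLabel, entryLabel, h3 e, h4 _ _ ⟨e, Or.inl ⟨rfl, rfl⟩⟩,
      h4 _ _ ⟨e, Or.inr ⟨rfl, rfl⟩⟩]

open Classical in
/-- The pairings with the property `Q`. -/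
def pairingsWith (G : LabelledGraph) (Q : (G.E → G.E) → Prop) : Finset (G.E → G.E) :=
  Finset.univ.filter fun φ => φ ∈ G.pairings ∧ Q φ

lemma mem_pairingsWith {G : LabelledGraph} {Q : (G.E → G.E) → Prop} {φ : G.E → G.E} :
    φ ∈ G.pairingsWith Q ↔ φ ∈ G.pairings ∧ Q φ := by
  simp [pairingsWith]

lemma card_respecting (G : LabelledGraph) (N : ℕ) (φ : G.E → G.E) :
    Nat.card {i : G.V → Fin N // ∀ u v, G.VertexRel φ u v → i u = i v} =
      N ^ Nat.card (G.identify φ).V := by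
  let e : {i : G.V → Fin N // ∀ u v, G.VertexRel φ u v → i u = i v} ≃
      (Quot (G.VertexRel φ) → Fin N) :=
    { toFun := fun i => Quot.lift i.1 i.2
      invFun := fun g => ⟨fun v => g (Quot.mk _ v), fun _ _ h => congrArg g (Quot.sound h)⟩
      left_inv := fun i => rfl
      right_inv := fun g => by ext ⟨v⟩; rfl }
  rw [Nat.card_congr e, Nat.card_fun, Nat.card_fin]
  rfl

open scoped Classical in
-- Exchange of the two sums: a pairing is counted once for every index map that descends to the
-- glued graph.
lemma sum_card_labelPairings (G : LabelledGraph) (N : ℕ) (Q : (G.E → G.E) → Prop) :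
    (∑ i : G.V → Fin N,
      (Nat.card {φ : G.E → G.E // φ ∈ labelPairings (G.entryLabel i) ∧ Q φ} : ℝ)) =
      ∑ φ ∈ G.pairingsWith Q, (N : ℝ) ^ Nat.card (G.identify φ).V := by
  classical
  have h1 : ∀ i : G.V → Fin N,
      (Nat.card {φ : G.E → G.E // φ ∈ labelPairings (G.entryLabel i) ∧ Q φ} : ℝ) =
        ∑ φ ∈ G.pairingsWith Q, if ∀ u v, G.VertexRel φ u v → i u = i v then 1 else 0 := by
    intro i
    rw [Finset.sum_boole, Nat.card_eq_fintype_card, Fintype.card_subtype]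
    congr 2
    ext φ
    simp only [Finset.mem_filter, Finset.mem_univ, true_and, mem_labelPairings_entryLabel,
      mem_pairingsWith]
    tauto
  simp_rw [h1]
  rw [Finset.sum_comm]
  refine Finset.sum_congr rfl fun φ _ => ?_
  rw [Finset.sum_boole, ← Fintype.card_subtype, ← Nat.card_eq_fintype_card, card_respecting,
    Nat.cast_pow]

variable {Ω : Type*} [MeasurableSpace Ω] {P : Measure Ω} [IsProbabilityMeasure P] {N : ℕ}
  {x : ℕ × Fin N × Fin N → Ω → ℝ}

lemma hasAllMoments_monomial (G : LabelledGraph) (hx : IsStdGaussianFamily x P)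
    (i : G.V → Fin N) : HasAllMoments (fun ω => ∏ e, withOne x (G.entryLabel i e) ω) P :=
  HasAllMoments.prod fun _ _ => hx.hasAllMoments_withOne _

open scoped Classical in
lemma hasAllMoments_graphSum (G : LabelledGraph) (hx : IsStdGaussianFamily x P) :
    HasAllMoments (G.graphSum x) P :=
  HasAllMoments.sum fun i _ => G.hasAllMoments_monomial hx i

open scoped Classical in
lemma integral_graphSum (G : LabelledGraph) (hx : IsStdGaussianFamily x P) :
    ∫ ω, G.graphSum x ω ∂P =
      ∑ φ ∈ G.pairingsWith fun _ => True, (N : ℝ) ^ Nat.card (G.identify φ).V := by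
  rw [← sum_card_labelPairings]
  simp_rw [graphSum]
  rw [integral_finsetSum _ fun i _ => (G.hasAllMoments_monomial hx i).integrable]
  refine Finset.sum_congr rfl fun i _ => ?_
  rw [hx.integral_prod]
  congr 1
  exact Nat.card_congr (Equiv.subtypeEquivRight fun φ => by simp)

open scoped Classical in
-- Centring is done monomial by monomial, so that `integral_prod_centred` applies for each index
-- map.
lemma graphSum_sub_integral (G : LabelledGraph) (hx : IsStdGaussianFamily x P) (ω : Ω) :
    G.graphSum x ω - ∫ ω, G.graphSum x ω ∂P = ∑ i : G.V → Fin N,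
      ((∏ e, withOne x (G.entryLabel i e) ω) -
        ∫ ω', ∏ e, withOne x (G.entryLabel i e) ω' ∂P) := by
  rw [Finset.sum_sub_distrib, graphSum]
  congr 1
  simp_rw [graphSum]
  exact integral_finsetSum _ fun i _ => (G.hasAllMoments_monomial hx i).integrable

open scoped Classical in
lemma sum_integral_prod_centred (G : LabelledGraph) (hx : IsStdGaussianFamily x P) {J : Type*}
    [Fintype J] [DecidableEq J] (p : G.E → J) (T : Finset J) :
    ∑ i : G.V → Fin N,
      (∫ ω, ∏ j ∈ T, (fibreMonomial x (G.entryLabel i) p j ω -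
        ∫ ω', fibreMonomial x (G.entryLabel i) p j ω' ∂P) ∂P) *
      (∫ ω, ∏ j ∈ Tᶜ, (fibreMonomial x (G.entryLabel i) p j ω -
        ∫ ω', fibreMonomial x (G.entryLabel i) p j ω' ∂P) ∂P) =
      ∑ φ ∈ G.pairingsWith fun φ => (∀ e, p (φ e) ∈ T ↔ p e ∈ T) ∧ PreservesNoFibre p φ,
        (N : ℝ) ^ Nat.card (G.identify φ).V := by
  rw [← sum_card_labelPairings]
  exact Finset.sum_congr rfl fun i _ => hx.integral_prod_centred _ p T

/-- The disjoint union of a finite family of labelled graphs. -/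
def sigmaGraph {J : Type} [Fintype J] (F : J → LabelledGraph) : LabelledGraph where
  V := Σ j, (F j).V
  E := Σ j, (F j).E
  src := Sigma.map id fun j => (F j).src
  tgt := Sigma.map id fun j => (F j).tgt
  label e := (F e.1).label e.2

open scoped Classical in
-- A family of index maps is an index map of the disjoint union, and the monomial of the `j`-th
-- graph is the fibre monomial over `j`. The set `T` makes products of two expectations available,
-- as the moment recursion requires.
theorem integral_prod_graphSum {J : Type} [Fintype J] [DecidableEq J] (F : J → LabelledGraph)
    (hx : IsStdGaussianFamily x P) (T : Finset J) :
    (∫ ω, ∏ j ∈ T, ((F j).graphSum x ω - ∫ ω', (F j).graphSum x ω' ∂P) ∂P) *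
      (∫ ω, ∏ j ∈ Tᶜ, ((F j).graphSum x ω - ∫ ω', (F j).graphSum x ω' ∂P) ∂P) =
      ∑ φ ∈ (sigmaGraph F).pairingsWith fun φ =>
        (∀ e, (φ e).1 ∈ T ↔ e.1 ∈ T) ∧ PreservesNoFibre (fun e : Σ j, (F j).E => e.1) φ,
        (N : ℝ) ^ Nat.card ((sigmaGraph F).identify φ).V := by
  have h1 := (sigmaGraph F).sum_integral_prod_centred hx (fun e : Σ j, (F j).E => e.1) T
  refine Eq.trans ?_ h1
  simp_rw [fun j ω => (F j).graphSum_sub_integral hx ω]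
  rw [integral_prod_sum_mul_integral_prod_sum (fun j (i : (F j).V → Fin N) ω =>
    (∏ e, withOne x ((F j).entryLabel i e) ω) -
      ∫ ω', ∏ e, withOne x ((F j).entryLabel i e) ω' ∂P) fun j i =>
        ((F j).hasAllMoments_monomial hx i).sub (HasAllMoments.const _)]
  let ε : ((j : J) → (F j).V → Fin N) ≃ ((sigmaGraph F).V → Fin N) :=
    (Equiv.piCurry fun j (_ : (F j).V) => Fin N).symm
  refine Fintype.sum_equiv ε _ _ fun i => ?_
  have h2 : ∀ j ω, fibreMonomial x ((sigmaGraph F).entryLabel (ε i))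
      (fun e : Σ j, (F j).E => e.1) j ω =
      ∏ e, withOne x ((F j).entryLabel (i j) e) ω := by
    intro j ω
    refine fibreMonomial_eq_prod ((sigmaGraph F).entryLabel (ε i)) (fun e : Σ j, (F j).E => e.1) j
      (Sigma.mk j) sigma_mk_injective (fun e => ?_) ω
    constructor
    · rintro rfl; exact ⟨e.2, rfl⟩
    · rintro ⟨e, rfl⟩; rfl
  simp_rw [h2]

open scoped Classical in
-- The analogue for two factors in terms of `disjUnion`, the graph through which the limiting
-- covariance is defined.
theorem integral_mul_graphSum (G H : LabelledGraph) (hx : IsStdGaussianFamily x P) :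
    ∫ ω, (G.graphSum x ω - ∫ ω', G.graphSum x ω' ∂P) *
      (H.graphSum x ω - ∫ ω', H.graphSum x ω' ∂P) ∂P =
      ∑ φ ∈ (G.disjUnion H).pairingsWith fun φ =>
        PreservesNoFibre (fun e => side ((G.disjUnion H).src e)) φ,
        (N : ℝ) ^ Nat.card ((G.disjUnion H).identify φ).V := by
  -- For `T = univ` the second expectation is that of an empty product and the block condition is
  -- vacuous.
  have h1 := (G.disjUnion H).sum_integral_prod_centred hx
    (fun e => side ((G.disjUnion H).src e)) Finset.univ
  simp only [Finset.mem_univ, iff_self, implies_true, true_and, Finset.compl_univ,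
    Finset.prod_empty, integral_const, probReal_univ, smul_eq_mul, mul_one,
    Fintype.prod_bool] at h1
  refine Eq.trans ?_ h1
  simp_rw [graphSum_sub_integral _ hx, Finset.sum_mul_sum]
  have hm : ∀ (i : G.V → Fin N) (k : H.V → Fin N), Integrable (fun ω =>
      ((∏ e, withOne x (G.entryLabel i e) ω) - ∫ ω', ∏ e, withOne x (G.entryLabel i e) ω' ∂P) *
      ((∏ e, withOne x (H.entryLabel k e) ω) -
        ∫ ω', ∏ e, withOne x (H.entryLabel k e) ω' ∂P)) P := fun i k =>
    (((G.hasAllMoments_monomial hx i).sub (HasAllMoments.const _)).mul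
      ((H.hasAllMoments_monomial hx k).sub (HasAllMoments.const _))).integrable
  rw [integral_finsetSum _ fun i _ => integrable_finsetSum _ fun k _ => hm i k]
  simp_rw [fun i => integral_finsetSum (Finset.univ : Finset (H.V → Fin N)) fun k _ => hm i k]
  rw [← Fintype.sum_prod_type']
  let ε : (G.V → Fin N) × (H.V → Fin N) ≃ ((G.disjUnion H).V → Fin N) :=
    (Equiv.sumArrowEquivProdArrow G.V H.V (Fin N)).symm
  refine Fintype.sum_equiv ε _ _ ?_
  rintro ⟨i, k⟩
  have h2 : ∀ ω, fibreMonomial x ((G.disjUnion H).entryLabel (ε (i, k)))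
      (fun e => side ((G.disjUnion H).src e)) true ω =
      ∏ e, withOne x (G.entryLabel i e) ω := by
    intro ω
    refine fibreMonomial_eq_prod ((G.disjUnion H).entryLabel (ε (i, k)))
      (fun e => side ((G.disjUnion H).src e)) true (Sum.inl : G.E → G.E ⊕ H.E)
      Sum.inl_injective (fun e => ?_) ω
    rcases e with e | e
    · exact ⟨fun _ => ⟨e, rfl⟩, fun _ => rfl⟩
    · refine ⟨fun h => Bool.noConfusion (h : false = true), ?_⟩
      rintro ⟨e', h⟩
      cases h
  have h3 : ∀ ω, fibreMonomial x ((G.disjUnion H).entryLabel (ε (i, k)))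
      (fun e => side ((G.disjUnion H).src e)) false ω =
      ∏ e, withOne x (H.entryLabel k e) ω := by
    intro ω
    refine fibreMonomial_eq_prod ((G.disjUnion H).entryLabel (ε (i, k)))
      (fun e => side ((G.disjUnion H).src e)) false (Sum.inr : H.E → G.E ⊕ H.E)
      Sum.inr_injective (fun e => ?_) ω
    rcases e with e | e
    · refine ⟨fun h => Bool.noConfusion (h : true = false), ?_⟩
      rintro ⟨e', h⟩
      cases h
    · exact ⟨fun _ => ⟨e, rfl⟩, fun _ => rfl⟩
  simp_rw [h2, h3]

end LabelledGraph

/-! ### Asymptotics of means, covariances and joint moments -/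

lemma tendsto_natCast_rpow_of_nonpos {D : ℝ} (hD : D ≤ 0) :
    Tendsto (fun N : ℕ => (N : ℝ) ^ D) atTop (𝓝 (if D = 0 then 1 else 0)) := by
  split_ifs with h
  · simp [h]
  · have h1 : 0 < -D := by
      rcases hD.lt_or_eq with h' | h'
      · linarith
      · exact absurd h' h
    simpa [Function.comp_def] using (tendsto_rpow_neg_atTop h1).comp
      (tendsto_natCast_atTop_atTop (R := ℝ))

namespace LabelledGraph

open scoped Classical in
lemma edgeExponent_eq_sum (G : LabelledGraph) :
    G.edgeExponent = ∑ e, if G.label e = none then (1 : ℝ) else 1 / 2 := by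
  rw [Finset.sum_ite, Finset.sum_const, Finset.sum_const, edgeExponent,
    Set.ncard_eq_toFinset_card', Set.ncard_eq_toFinset_card']
  simp only [Set.toFinset_ofPred, nsmul_eq_mul]
  ring

lemma edgeExponent_sigmaGraph {J : Type} [Fintype J] (F : J → LabelledGraph) :
    (sigmaGraph F).edgeExponent = ∑ j, (F j).edgeExponent := by
  classical
  simp_rw [edgeExponent_eq_sum]
  exact Fintype.sum_sigma (fun e : Σ j, (F j).E =>
    if (F e.1).label e.2 = none then (1 : ℝ) else 1 / 2)

lemma edgeExponent_disjUnion (G H : LabelledGraph) :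
    (G.disjUnion H).edgeExponent = G.edgeExponent + H.edgeExponent := by
  classical
  simp_rw [edgeExponent_eq_sum]
  exact Fintype.sum_sum_type (fun e : G.E ⊕ H.E =>
    if Sum.elim G.label H.label e = none then (1 : ℝ) else 1 / 2)

lemma sigmaGraph_connected_fibres {J : Type} [Fintype J] (F : J → LabelledGraph)
    (hF : ∀ j, (F j).Connected) (u v : (sigmaGraph F).V) (h : u.1 = v.1) :
    Quot.mk (sigmaGraph F).EdgeRel u = Quot.mk (sigmaGraph F).EdgeRel v := by
  obtain ⟨j, u⟩ := u
  obtain ⟨j', v⟩ := v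
  obtain rfl : j = j' := h
  exact DirectedGraph.quot_mk_eq_map (H := (sigmaGraph F).toDirectedGraph)
    (fun v : (F j).V => (⟨j, v⟩ : Σ j, (F j).V))
    (fun e => Quot.sound ⟨(⟨j, e⟩ : Σ j, (F j).E), rfl, rfl⟩)
    (((DirectedGraph.connected_iff _).1 (hF j)).1 u v)

/-- The centred value of a product graph, divided by its order of magnitude. -/
def centredValue (G : LabelledGraph) {Ω : Type*} [MeasurableSpace Ω] (P : Measure Ω) {N : ℕ}
    (x : ℕ × Fin N × Fin N → Ω → ℝ) (ω : Ω) : ℝ :=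
  ((N : ℝ) ^ (G.edgeExponent + 1 / 2))⁻¹ * (G.graphSum x ω - ∫ ω', G.graphSum x ω' ∂P)

/-- The exponent of the contribution of a pairing to a joint moment of `k` centred values. -/
def excess (G : LabelledGraph) (k : ℕ) (φ : G.E → G.E) : ℝ :=
  Nat.card (G.identify φ).V - G.edgeExponent - k / 2

section FixedSize

variable {Ω : Type*} [MeasurableSpace Ω] {P : Measure Ω} [IsProbabilityMeasure P] {N : ℕ}
  {x : ℕ × Fin N × Fin N → Ω → ℝ}

lemma hasAllMoments_centredValue (G : LabelledGraph) (hx : IsStdGaussianFamily x P) :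
    HasAllMoments (G.centredValue P x) P :=
  ((G.hasAllMoments_graphSum hx).sub (HasAllMoments.const _)).const_mul _

lemma integral_centredValue (G : LabelledGraph) (hx : IsStdGaussianFamily x P) :
    ∫ ω, G.centredValue P x ω ∂P = 0 := by
  simp_rw [centredValue]
  rw [integral_const_mul, integral_sub (G.hasAllMoments_graphSum hx).integrable
    (integrable_const _)]
  simp

lemma rpow_excess (G : LabelledGraph) (hN : 0 < N) (k : ℕ) (φ : G.E → G.E) :
    ((N : ℝ) ^ (G.edgeExponent + (k : ℝ) / 2))⁻¹ * (N : ℝ) ^ Nat.card (G.identify φ).V =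
      (N : ℝ) ^ G.excess k φ := by
  have hN' : (0 : ℝ) < N := by exact_mod_cast hN
  rw [← Real.rpow_neg hN'.le, ← Real.rpow_natCast, ← Real.rpow_add hN']
  congr 1
  rw [excess]; ring

lemma integral_prod_centredValue {J : Type} [Fintype J] [DecidableEq J] (F : J → LabelledGraph)
    (hx : IsStdGaussianFamily x P) (hN : 0 < N) (T : Finset J) :
    (∫ ω, ∏ j ∈ T, (F j).centredValue P x ω ∂P) *
      (∫ ω, ∏ j ∈ Tᶜ, (F j).centredValue P x ω ∂P) =
      ∑ φ ∈ (sigmaGraph F).pairingsWith fun φ =>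
        (∀ e, (φ e).1 ∈ T ↔ e.1 ∈ T) ∧ PreservesNoFibre (fun e : Σ j, (F j).E => e.1) φ,
        (N : ℝ) ^ (sigmaGraph F).excess (Fintype.card J) φ := by
  have hN' : (0 : ℝ) < N := by exact_mod_cast hN
  simp_rw [← rpow_excess _ hN, ← Finset.mul_sum, ← integral_prod_graphSum F hx T, centredValue,
    Finset.prod_mul_distrib, integral_const_mul]
  have h1 : (∏ j ∈ T, ((N : ℝ) ^ ((F j).edgeExponent + 1 / 2))⁻¹) *
      ∏ j ∈ Tᶜ, ((N : ℝ) ^ ((F j).edgeExponent + 1 / 2))⁻¹ =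
      ((N : ℝ) ^ ((sigmaGraph F).edgeExponent + (Fintype.card J : ℝ) / 2))⁻¹ := by
    rw [Finset.prod_mul_prod_compl, Finset.prod_inv_distrib, ← Real.rpow_sum_of_pos hN',
      Finset.sum_add_distrib, edgeExponent_sigmaGraph]
    simp [div_eq_mul_inv]
  rw [← h1]
  ring

lemma integral_mul_centredValue (G H : LabelledGraph) (hx : IsStdGaussianFamily x P)
    (hN : 0 < N) :
    ∫ ω, G.centredValue P x ω * H.centredValue P x ω ∂P =
      ∑ φ ∈ (G.disjUnion H).pairingsWith fun φ =>
        PreservesNoFibre (fun e => side ((G.disjUnion H).src e)) φ,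
        (N : ℝ) ^ (G.disjUnion H).excess 2 φ := by
  have hN' : (0 : ℝ) < N := by exact_mod_cast hN
  simp_rw [← rpow_excess _ hN, ← Finset.mul_sum]
  rw [← integral_mul_graphSum G H hx, ← integral_const_mul]
  congr! 2 with ω
  rw [centredValue, centredValue, mul_mul_mul_comm, ← mul_inv, ← Real.rpow_add hN',
    edgeExponent_disjUnion]
  congr 3
  push_cast
  ring

end FixedSize

/-- Since `edgeExponent` is the number of glued edges, this is `card_identify_le` read as a bound on
the power of `N`. -/
lemma excess_nonpos_of_fibres (D : LabelledGraph) {J : Type*} [Fintype J] (p : D.V → J)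
    (hsurj : Function.Surjective p)
    (hconn : ∀ u v, p u = p v → Quot.mk D.EdgeRel u = Quot.mk D.EdgeRel v) {φ : D.E → D.E}
    (hφ : φ ∈ D.pairings) (hno : PreservesNoFibre (fun e => p (D.src e)) φ) :
    D.excess (Fintype.card J) φ ≤ 0 ∧ (D.excess (Fintype.card J) φ = 0 →
      ∀ a, ∃ b ≠ a, ∀ e, (p (D.src (φ e)) = a ∨ p (D.src (φ e)) = b) ↔
          (p (D.src e) = a ∨ p (D.src e) = b)) := by
  obtain ⟨h1, h2⟩ := DirectedGraph.card_identify_le p hsurj hconn hno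
  rw [excess, edgeExponent_eq hφ]
  refine ⟨?_, fun h => h2 ?_⟩
  · have : (2 : ℝ) * Nat.card (D.identify φ).V ≤
        2 * Nat.card (D.identify φ).E + Fintype.card J := by exact_mod_cast h1
    linarith
  · have : (2 : ℝ) * Nat.card (D.identify φ).V =
        2 * Nat.card (D.identify φ).E + Fintype.card J := by linarith
    exact_mod_cast this

section Limits

variable {Ω : ℕ → Type*} [∀ N, MeasurableSpace (Ω N)] {P : (N : ℕ) → Measure (Ω N)}
  [∀ N, IsProbabilityMeasure (P N)] {x : (N : ℕ) → ℕ × Fin N × Fin N → Ω N → ℝ}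

/-- The covariances of the normalised values converge. -/
theorem tendsto_integral_mul_centredValue (G H : LabelledGraph) (hG : G.Connected)
    (hH : H.Connected) (hx : ∀ N, IsStdGaussianFamily (x N) (P N)) :
    Tendsto (fun N => ∫ ω, G.centredValue (P N) (x N) ω * H.centredValue (P N) (x N) ω ∂(P N))
      atTop (𝓝 ((G.disjUnion H).biatomicPairings.ncard : ℝ)) := by
  classical
  set D := G.disjUnion H
  have h1 : Tendsto (fun N : ℕ => ∑ φ ∈ D.pairingsWith fun φ =>
      PreservesNoFibre (fun e => side (D.src e)) φ, (N : ℝ) ^ D.excess 2 φ) atTop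
      (𝓝 (∑ φ ∈ D.pairingsWith fun φ => PreservesNoFibre (fun e => side (D.src e)) φ,
        if D.excess 2 φ = 0 then (1 : ℝ) else 0)) := by
    refine tendsto_finsetSum _ fun φ hφ => tendsto_natCast_rpow_of_nonpos ?_
    rw [mem_pairingsWith] at hφ
    simpa using (D.excess_nonpos_of_fibres side (side_surjective hG hH) (side_connected hG hH)
      hφ.1 hφ.2).1
  have h2 : (D.biatomicPairings.ncard : ℝ) = ∑ φ ∈ D.pairingsWith fun φ =>
      PreservesNoFibre (fun e => side (D.src e)) φ, if D.excess 2 φ = 0 then (1 : ℝ) else 0 := by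
    rw [Finset.sum_boole, ← Set.ncard_coe_finset]
    congr 2
    ext φ
    simp only [Finset.coe_filter, Set.mem_ofPred_eq, mem_pairingsWith, and_assoc]
    rw [mem_biatomicPairings_iff hG hH]
    refine and_congr_right fun _ => and_congr_right fun _ => ?_
    rw [excess, sub_sub, sub_eq_zero]
    norm_num
    rfl
  rw [h2]
  refine h1.congr' ?_
  filter_upwards [eventually_gt_atTop 0] with N hN
  exact (integral_mul_centredValue G H (hx N) hN).symm

/-- The joint moments of the normalised values asymptotically satisfy the recursion for the
moments of Gaussian vectors. -/
theorem tendsto_integral_prod_centredValue_sub {J : Type} [Fintype J] [DecidableEq J]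
    (F : J → LabelledGraph) (hF : ∀ j, (F j).Connected)
    (hx : ∀ N, IsStdGaussianFamily (x N) (P N)) (a : J) :
    Tendsto (fun N => ∫ ω, ∏ j, (F j).centredValue (P N) (x N) ω ∂(P N) -
      ∑ b ∈ Finset.univ.erase a,
        (∫ ω, ∏ j ∈ {a, b}, (F j).centredValue (P N) (x N) ω ∂(P N)) *
        ∫ ω, ∏ j ∈ {a, b}ᶜ, (F j).centredValue (P N) (x N) ω ∂(P N)) atTop (𝓝 0) := by
  classical
  set D := sigmaGraph F
  let p : D.E → J := fun e => e.1
  let Q : Finset (D.E → D.E) := D.pairingsWith fun φ => PreservesNoFibre p φ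
  -- The total coefficient of the power of `N` coming from `φ`: one minus the number of `b ≠ a` for
  -- which `φ` respects the splitting into `{a, b}` and its complement.
  let c : (D.E → D.E) → ℝ := fun φ => 1 - ∑ b ∈ Finset.univ.erase a,
    if ∀ e, p (φ e) ∈ ({a, b} : Finset J) ↔ p e ∈ ({a, b} : Finset J) then (1 : ℝ) else 0
  have hT : ∀ (N : ℕ), 0 < N → ∀ T : Finset J,
      (∫ ω, ∏ j ∈ T, (F j).centredValue (P N) (x N) ω ∂(P N)) *
      (∫ ω, ∏ j ∈ Tᶜ, (F j).centredValue (P N) (x N) ω ∂(P N)) =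
      ∑ φ ∈ Q, (N : ℝ) ^ D.excess (Fintype.card J) φ *
        if ∀ e, p (φ e) ∈ T ↔ p e ∈ T then (1 : ℝ) else 0 := by
    intro N hN T
    rw [integral_prod_centredValue F (hx N) hN T]
    simp_rw [mul_ite, mul_one, mul_zero]
    rw [← Finset.sum_filter]
    refine Finset.sum_congr ?_ fun _ _ => rfl
    ext φ
    simp only [Q, Finset.mem_filter, mem_pairingsWith]
    exact ⟨fun h => ⟨⟨h.1, h.2.2⟩, h.2.1⟩, fun h => ⟨h.1.1, h.2, h.1.2⟩⟩
  have h1 : ∀ᶠ N : ℕ in atTop, ∑ φ ∈ Q, (N : ℝ) ^ D.excess (Fintype.card J) φ * c φ =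
      ∫ ω, ∏ j, (F j).centredValue (P N) (x N) ω ∂(P N) -
      ∑ b ∈ Finset.univ.erase a,
        (∫ ω, ∏ j ∈ {a, b}, (F j).centredValue (P N) (x N) ω ∂(P N)) *
        ∫ ω, ∏ j ∈ {a, b}ᶜ, (F j).centredValue (P N) (x N) ω ∂(P N) := by
    filter_upwards [eventually_gt_atTop 0] with N hN
    have h2 := hT N hN Finset.univ
    simp only [Finset.compl_univ, Finset.prod_empty, integral_const, probReal_univ, smul_eq_mul,
      mul_one, Finset.mem_univ, iff_self, implies_true, if_true] at h2
    rw [h2, Finset.sum_congr rfl fun b _ => hT N hN {a, b}, Finset.sum_comm,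
      ← Finset.sum_sub_distrib]
    refine Finset.sum_congr rfl fun φ _ => ?_
    rw [← Finset.mul_sum]
    simp only [c]
    ring
  refine Tendsto.congr' h1 ?_
  rw [← Finset.sum_const_zero (s := Q)]
  refine tendsto_finsetSum _ fun φ hφ => ?_
  rw [mem_pairingsWith] at hφ
  have hsurj : Function.Surjective (fun v : D.V => v.1) := fun j => by
    obtain ⟨v⟩ := (hF j).nonempty
    exact ⟨⟨j, v⟩, rfl⟩
  obtain ⟨h3, h4⟩ := D.excess_nonpos_of_fibres (fun v : D.V => v.1) hsurj
    (sigmaGraph_connected_fibres F hF) hφ.1 hφ.2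
  have h5 := (tendsto_natCast_rpow_of_nonpos h3).mul_const (c φ)
  convert h5 using 2
  split_ifs with h0
  -- At excess zero the partner `b` exists and is unique, so `c φ = 0`: an edge of `a` paired
  -- outside `a` must land in every admissible partner.
  · obtain ⟨b, hba, hb⟩ := h4 h0 a
    have hb' : ∀ e, (p (φ e) = a ∨ p (φ e) = b) ↔ (p e = a ∨ p e = b) := hb
    rw [one_mul, eq_comm, sub_eq_zero, eq_comm, Finset.sum_eq_single b]
    · simp [hb']
    · intro b' hb1 hbb'
      have hba' : b' ≠ a := Finset.ne_of_mem_erase hb1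
      refine if_neg fun h => ?_
      obtain ⟨e, he, he'⟩ := hφ.2 a
      have h6 := (hb' e).2 (Or.inl he)
      have h7 := (h e).2 (by simp [he])
      simp only [Finset.mem_insert, Finset.mem_singleton] at h7
      have h8 := h6.resolve_left he'
      have h9 := h7.resolve_left he'
      exact hbb' (h9.symm.trans h8)
    · intro h
      exact absurd (Finset.mem_erase.2 ⟨hba, Finset.mem_univ _⟩) h
  · rw [zero_mul]

/-- The expectation of the value of a product graph. -/
theorem tendsto_integral_graphSum (G : LabelledGraph) (hG : G.Connected)
    (hx : ∀ N, IsStdGaussianFamily (x N) (P N)) :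
    Tendsto (fun N : ℕ => ((N : ℝ) ^ (G.edgeExponent + 1 / 2))⁻¹ *
      (∫ ω, G.graphSum (x N) ω ∂(P N)) - (G.atomicPairings.ncard : ℝ) * √(N : ℝ))
      atTop (𝓝 0) := by
  classical
  let Q := G.pairingsWith fun _ => True
  have h1 : (G.atomicPairings.ncard : ℝ) = ∑ φ ∈ Q,
      if (Nat.card (G.identify φ).V : ℝ) = G.edgeExponent + 1 then (1 : ℝ) else 0 := by
    rw [Finset.sum_boole, ← Set.ncard_coe_finset]
    congr 2
    ext φ
    simp only [Q, Finset.coe_filter, Set.mem_ofPred_eq, mem_pairingsWith, and_true]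
    exact mem_atomicPairings_iff hG
  have h2 : ∀ᶠ N : ℕ in atTop, ∑ φ ∈ Q, ((N : ℝ) ^ G.excess 1 φ -
      (if (Nat.card (G.identify φ).V : ℝ) = G.edgeExponent + 1 then (1 : ℝ) else 0) * √(N : ℝ)) =
      ((N : ℝ) ^ (G.edgeExponent + 1 / 2))⁻¹ *
      (∫ ω, G.graphSum (x N) ω ∂(P N)) - (G.atomicPairings.ncard : ℝ) * √(N : ℝ) := by
    filter_upwards [eventually_gt_atTop 0] with N hN
    rw [Finset.sum_sub_distrib, h1, Finset.sum_mul, G.integral_graphSum (hx N), Finset.mul_sum]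
    congr 1
    refine Finset.sum_congr rfl fun φ _ => ?_
    rw [← G.rpow_excess hN, Nat.cast_one]
  refine Tendsto.congr' h2 ?_
  rw [← Finset.sum_const_zero (s := Q)]
  refine tendsto_finsetSum _ fun φ hφ => ?_
  rw [mem_pairingsWith] at hφ
  split_ifs with h
  -- A tree contributes exactly `√N`, which the centring cancels. In the other case vertices do not
  -- outnumber edges and the exponent is at most `-1/2`.
  · have h3 : G.excess 1 φ = 1 / 2 := by rw [excess, h]; push_cast; ring
    simp [h3, Real.sqrt_eq_rpow]
  · have h3 := card_le_card_add_card_quot (G.identify φ).src (G.identify φ).tgt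
    have h4 : Nat.card (Quot (G.identify φ).EdgeRel) ≤ 1 := by
      have h5 := (DirectedGraph.connected_iff _).1 (DirectedGraph.Connected.identify hG φ)
      have : Subsingleton (Quot (G.identify φ).EdgeRel) :=
        ⟨by rintro ⟨u⟩ ⟨v⟩; exact h5.1 u v⟩
      exact Finite.card_le_one_iff_subsingleton.2 this
    change _ ≤ _ + Nat.card (Quot (G.identify φ).EdgeRel) at h3
    rw [edgeExponent_eq hφ.1] at h
    have h6 : Nat.card (G.identify φ).V ≤ Nat.card (G.identify φ).E := by
      have : Nat.card (G.identify φ).V ≠ Nat.card (G.identify φ).E + 1 :=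
        fun h' => h (by exact_mod_cast h')
      omega
    have h7 : G.excess 1 φ < 0 := by
      have : (Nat.card (G.identify φ).V : ℝ) ≤ Nat.card (G.identify φ).E := by exact_mod_cast h6
      rw [excess, edgeExponent_eq hφ.1]
      push_cast
      linarith
    simpa [h7.ne] using tendsto_natCast_rpow_of_nonpos h7.le

end Limits

end LabelledGraph

/-! ### The method of moments for Gaussian limits -/

/-- Taylor's estimate for the exponential function on the imaginary axis. -/
lemma norm_exp_sub_taylor_le (c : ℂ) (hc : c.re = 0) (n : ℕ) :
    ‖Complex.exp c - ∑ k ∈ Finset.range n, c ^ k / (k.factorial : ℂ)‖ ≤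
      ‖c‖ ^ n / (n.factorial : ℝ) := by
  induction n generalizing c with
  | zero => simp [Complex.norm_exp, hc]
  | succ n ih =>
    let f : ℝ → ℂ := fun s => Complex.exp (s * c) -
      ∑ k ∈ Finset.range (n + 1), ((s : ℂ) * c) ^ k / (k.factorial : ℂ)
    -- Along the segment from `0` to `c`, the derivative of the remainder is `c` times the remainder
    -- of the previous order, so the induction hypothesis bounds it by the derivative of `B`.
    let f' : ℝ → ℂ := fun s => c * (Complex.exp (s * c) -
      ∑ k ∈ Finset.range n, ((s : ℂ) * c) ^ k / (k.factorial : ℂ))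
    have hlin : ∀ s : ℝ, HasDerivAt (fun s : ℝ => (s : ℂ) * c) c s := fun s => by
      simpa using (Complex.ofRealCLM.hasDerivAt (x := s)).mul_const c
    have hf : ∀ s, HasDerivAt f (f' s) s := by
      intro s
      have h1 := (hlin s).cexp
      have h2 : ∀ k ∈ Finset.range n, HasDerivAt
          (fun s : ℝ => ((s : ℂ) * c) ^ (k + 1) / ((k + 1).factorial : ℂ))
          (c * (((s : ℂ) * c) ^ k / (k.factorial : ℂ))) s := by
        intro k _
        have h3 := ((hlin s).pow (k + 1)).div_const ((k + 1).factorial : ℂ)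
        refine h3.congr_deriv ?_
        rw [Nat.factorial_succ]
        have : (k.factorial : ℂ) ≠ 0 := by exact_mod_cast k.factorial_ne_zero
        have : (k : ℂ) + 1 ≠ 0 := by exact_mod_cast k.succ_ne_zero
        push_cast
        field_simp
      have h4 := h1.sub ((HasDerivAt.fun_sum h2).add_const (1 : ℂ))
      refine (h4.congr_deriv ?_).congr_of_eventuallyEq (Eventually.of_forall fun s => ?_)
      · simp only [f']
        rw [← Finset.mul_sum]
        ring
      · simp only [f]
        rw [Finset.sum_range_succ']
        simp
    let B : ℝ → ℝ := fun s => s ^ (n + 1) * (‖c‖ ^ (n + 1) / ((n + 1).factorial : ℝ))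
    have hB : ∀ s, HasDerivAt B (‖c‖ * ((s * ‖c‖) ^ n / (n.factorial : ℝ))) s := by
      intro s
      refine ((hasDerivAt_pow (n + 1) s).mul_const _).congr_deriv ?_
      rw [Nat.factorial_succ]
      have : (n.factorial : ℝ) ≠ 0 := by exact_mod_cast n.factorial_ne_zero
      push_cast
      field_simp
      ring
    have key := image_norm_le_of_norm_deriv_right_le_deriv_boundary (a := 0) (b := 1)
      (f := f) (f' := f') (B := B) (fun s _ => (hf s).continuousAt.continuousWithinAt)
      (fun s _ => (hf s).hasDerivWithinAt) (by simp [f, B, Finset.sum_range_succ']) hB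
      (fun s hs => by
        have h5 := ih (s * c) (by simp [hc])
        rw [norm_mul (s : ℂ), Complex.norm_real, Real.norm_of_nonneg hs.1] at h5
        rw [norm_mul]
        exact mul_le_mul_of_nonneg_left h5 (norm_nonneg _))
      (x := 1) (by simp)
    simpa [f, B] using key

/-- The order `2 * n` is even so that the remainder `|X| ^ (2 * n)` is itself a moment. -/
lemma norm_integral_cexp_sub_le {Ω : Type*} [MeasurableSpace Ω] {P : Measure Ω}
    [IsProbabilityMeasure P] {X : Ω → ℝ} (hX : HasAllMoments X P) (n : ℕ) :
    ‖(∫ ω, Complex.exp (X ω * Complex.I) ∂P) - ∑ k ∈ Finset.range (2 * n),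
      ((∫ ω, X ω ^ k ∂P : ℝ) : ℂ) * (Complex.I ^ k / (k.factorial : ℂ))‖ ≤
      (∫ ω, X ω ^ (2 * n) ∂P) / ((2 * n).factorial : ℝ) := by
  have hint : ∀ k, Integrable (fun ω => X ω ^ k) P := fun k => (hX.pow k).integrable
  have hexp : Integrable (fun ω => Complex.exp (X ω * Complex.I)) P := by
    refine (integrable_const (1 : ℝ)).mono' ?_ (Eventually.of_forall fun ω => ?_)
    · have := hX.aemeasurable
      exact (by fun_prop : AEMeasurable (fun ω => Complex.exp (X ω * Complex.I)) P).aestronglyMeasurable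
    · rw [Complex.norm_exp_ofReal_mul_I]
  have h1 : ∑ k ∈ Finset.range (2 * n),
      ((∫ ω, X ω ^ k ∂P : ℝ) : ℂ) * (Complex.I ^ k / (k.factorial : ℂ)) =
      ∫ ω, ∑ k ∈ Finset.range (2 * n), ((X ω : ℂ) * Complex.I) ^ k / (k.factorial : ℂ) ∂P := by
    rw [integral_finsetSum]
    · refine Finset.sum_congr rfl fun k _ => ?_
      rw [← integral_complex_ofReal, ← integral_mul_const]
      refine integral_congr_ae (Eventually.of_forall fun ω => ?_)
      simp only [Complex.ofReal_pow, mul_pow]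
      ring
    · intro k _
      have := ((hint k).ofReal (𝕜 := ℂ)).mul_const (Complex.I ^ k / (k.factorial : ℂ))
      refine this.congr (Eventually.of_forall fun ω => ?_)
      simp only [RCLike.ofReal_pow, mul_pow]
      rw [mul_div_assoc]
      rfl
  have hsum : Integrable (fun ω => ∑ k ∈ Finset.range (2 * n),
      ((X ω : ℂ) * Complex.I) ^ k / (k.factorial : ℂ)) P := by
    refine integrable_finsetSum _ fun k _ => ?_
    have := ((hint k).ofReal (𝕜 := ℂ)).mul_const (Complex.I ^ k / (k.factorial : ℂ))
    refine this.congr (Eventually.of_forall fun ω => ?_)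
    simp only [RCLike.ofReal_pow, mul_pow]
    rw [mul_div_assoc]
    rfl
  rw [h1, ← integral_sub hexp hsum, ← integral_div]
  refine norm_integral_le_of_norm_le ((hint _).div_const _) (Eventually.of_forall fun ω => ?_)
  refine (norm_exp_sub_taylor_le _ (by simp) _).trans (le_of_eq ?_)
  rw [norm_mul, Complex.norm_I, mul_one, Complex.norm_real, Real.norm_eq_abs,
    (even_two_mul n).pow_abs]

/-- The right-hand side tends to `0` in `n`: this decay lets the moments control the characteristic
function. -/
lemma integral_pow_gaussianReal_even (v : NNReal) (n : ℕ) :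
    (∫ z, z ^ (2 * n) ∂(gaussianReal 0 v)) / ((2 * n).factorial : ℝ) =
      ((v : ℝ) / 2) ^ n / (n.factorial : ℝ) := by
  induction n with
  | zero => simp
  | succ n ih =>
    rw [show 2 * (n + 1) = 2 * n + 2 by ring, integral_pow_gaussianReal_add_two,
      Nat.factorial_succ (2 * n + 1), Nat.factorial_succ (2 * n), Nat.factorial_succ n, pow_succ]
    have h2 : ((2 * n).factorial : ℝ) ≠ 0 := by exact_mod_cast (2 * n).factorial_ne_zero
    have h3 : (n.factorial : ℝ) ≠ 0 := by exact_mod_cast n.factorial_ne_zero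
    rw [div_eq_iff h2] at ih
    rw [ih]
    push_cast
    field_simp
    ring

lemma hasAllMoments_id_gaussianReal (v : NNReal) : HasAllMoments (fun z => z) (gaussianReal 0 v) :=
  fun p hp => memLp_id_gaussianReal' p hp

/-- Convergence of all moments to those of a Gaussian variable implies convergence of the
characteristic functions. -/
theorem tendsto_integral_cexp_of_tendsto_moments {Ω : ℕ → Type*} [∀ N, MeasurableSpace (Ω N)]
    {P : (N : ℕ) → Measure (Ω N)} [∀ N, IsProbabilityMeasure (P N)] {X : (N : ℕ) → Ω N → ℝ}
    (hX : ∀ N, HasAllMoments (X N) (P N)) (v : NNReal)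
    (h : ∀ k, Tendsto (fun N => ∫ ω, X N ω ^ k ∂(P N)) atTop
      (𝓝 (∫ z, z ^ k ∂(gaussianReal 0 v)))) :
    Tendsto (fun N => ∫ ω, Complex.exp (X N ω * Complex.I) ∂(P N)) atTop
      (𝓝 (Complex.exp (-((v : ℝ) : ℂ) / 2))) := by
  have hgauss : Complex.exp (-((v : ℝ) : ℂ) / 2) =
      ∫ z, Complex.exp (z * Complex.I) ∂(gaussianReal 0 v) := by
    have := charFun_gaussianReal (μ := 0) (v := v) 1
    rw [charFun_apply_real] at this
    simp only [Complex.ofReal_one, one_mul, Complex.ofReal_zero, mul_zero, zero_mul, zero_sub,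
      one_pow, mul_one] at this
    rw [this, neg_div]
  rw [hgauss, Metric.tendsto_nhds]
  intro ε hε
  have h1 : Tendsto (fun n : ℕ => 2 * (((v : ℝ) / 2) ^ n / (n.factorial : ℝ))) atTop (𝓝 (2 * 0)) :=
    (FloorSemiring.tendsto_pow_div_factorial_atTop ((v : ℝ) / 2)).const_mul 2
  rw [mul_zero] at h1
  -- The factor `2` accounts for two Taylor remainders, that of the Gaussian and that of `X N`,
  -- which converges to it.
  obtain ⟨n, hn⟩ := (h1.eventually (gt_mem_nhds hε)).exists
  let S : (ℕ → ℝ) → ℂ := fun m => ∑ k ∈ Finset.range (2 * n),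
    ((m k : ℝ) : ℂ) * (Complex.I ^ k / (k.factorial : ℂ))
  have h2 : Tendsto (fun N => ‖S (fun k => ∫ ω, X N ω ^ k ∂(P N)) -
      S (fun k => ∫ z, z ^ k ∂(gaussianReal 0 v))‖ +
      (∫ ω, X N ω ^ (2 * n) ∂(P N)) / ((2 * n).factorial : ℝ) +
      (∫ z, z ^ (2 * n) ∂(gaussianReal 0 v)) / ((2 * n).factorial : ℝ)) atTop
      (𝓝 (0 + (∫ z, z ^ (2 * n) ∂(gaussianReal 0 v)) / ((2 * n).factorial : ℝ) +
      (∫ z, z ^ (2 * n) ∂(gaussianReal 0 v)) / ((2 * n).factorial : ℝ))) := by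
    refine ((Tendsto.add ?_ ((h (2 * n)).div_const _)).add_const _)
    refine tendsto_iff_norm_sub_tendsto_zero.1 ?_
    exact tendsto_finsetSum _ fun k _ =>
      ((Complex.continuous_ofReal.tendsto _).comp (h k)).mul_const _
  rw [integral_pow_gaussianReal_even, zero_add, ← two_mul] at h2
  filter_upwards [h2.eventually (gt_mem_nhds hn)] with N hN
  have h3 := norm_integral_cexp_sub_le (hX N) n
  have h4 := norm_integral_cexp_sub_le (hasAllMoments_id_gaussianReal v) n
  rw [integral_pow_gaussianReal_even] at h4
  rw [dist_eq_norm]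
  refine lt_of_le_of_lt ?_ hN
  refine (norm_sub_le_norm_sub_add_norm_sub _ (S fun k => ∫ ω, X N ω ^ k ∂(P N)) _).trans ?_
  have h5 := norm_sub_le_norm_sub_add_norm_sub (S fun k => ∫ ω, X N ω ^ k ∂(P N))
    (S fun k => ∫ z, z ^ k ∂(gaussianReal 0 v)) (∫ z, Complex.exp (z * Complex.I) ∂(gaussianReal 0 v))
  rw [norm_sub_rev (S fun k => ∫ z, z ^ k ∂(gaussianReal 0 v))] at h5
  simp only [S] at h5 ⊢
  linarith

section LinearCombination

variable {Ω : ℕ → Type*} [∀ N, MeasurableSpace (Ω N)] {P : (N : ℕ) → Measure (Ω N)}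
  [∀ N, IsProbabilityMeasure (P N)] {ι : Type*} [Fintype ι]

open scoped Classical in
lemma integral_linearCombination_pow {Ω : Type*} [MeasurableSpace Ω] {P : Measure Ω}
    [IsProbabilityMeasure P] {Y : ι → Ω → ℝ} (hY : ∀ i, HasAllMoments (Y i) P) (t : ι → ℝ) (k : ℕ) :
    ∫ ω, (∑ i, t i * Y i ω) ^ k ∂P =
      ∑ f : Fin k → ι, (∏ j, t (f j)) * ∫ ω, ∏ j, Y (f j) ω ∂P := by
  simp_rw [Fintype.sum_pow, Finset.prod_mul_distrib]
  rw [integral_finsetSum]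
  · simp_rw [integral_const_mul]
  · exact fun f _ => (HasAllMoments.prod fun j _ => hY (f j)).integrable.const_mul _

open scoped Classical in
-- A map on `Fin (k + 2)` is split into its values at `0` and at `b.succ` and a map on the remaining
-- `k` indices.
lemma sum_insert_two {k : ℕ} (b : Fin (k + 1)) (A : ι → ι → ℝ) (B : (Fin k → ι) → ℝ) :
    ∑ f : Fin (k + 2) → ι, A (f 0) (f b.succ) * B (fun j => f (b.succAbove j).succ) =
      (∑ i, ∑ i', A i i') * ∑ g, B g := by
  rw [← (Fin.insertNthEquiv (fun _ : Fin (k + 2) => ι) 0).sum_comp, Fintype.sum_prod_type,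
    Finset.sum_mul]
  refine Finset.sum_congr rfl fun i _ => ?_
  rw [← (Fin.insertNthEquiv (fun _ : Fin (k + 1) => ι) b).sum_comp, Fintype.sum_prod_type,
    Finset.sum_mul_sum]
  refine Finset.sum_congr rfl fun i' _ => Finset.sum_congr rfl fun g _ => ?_
  simp

/-- If the joint moments of centred variables asymptotically satisfy the Gaussian recursion, then
the moments of their linear combinations converge to Gaussian moments. -/
theorem tendsto_moments_linearCombination {Y : ι → (N : ℕ) → Ω N → ℝ}
    (hY : ∀ i N, HasAllMoments (Y i N) (P N)) (h0 : ∀ i N, ∫ ω, Y i N ω ∂(P N) = 0)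
    {C : ι → ι → ℝ}
    (hC : ∀ i j, Tendsto (fun N => ∫ ω, Y i N ω * Y j N ω ∂(P N)) atTop (𝓝 (C i j)))
    (hrec : ∀ (k : ℕ) (f : Fin (k + 2) → ι), Tendsto (fun N => ∫ ω, ∏ j, Y (f j) N ω ∂(P N) -
      ∑ b : Fin (k + 1), (∫ ω, Y (f 0) N ω * Y (f b.succ) N ω ∂(P N)) *
        ∫ ω, ∏ j : Fin k, Y (f (b.succAbove j).succ) N ω ∂(P N)) atTop (𝓝 0))
    (t : ι → ℝ) (v : NNReal) (hv : ∑ i, ∑ j, t i * t j * C i j = v) (k : ℕ) :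
    Tendsto (fun N => ∫ ω, (∑ i, t i * Y i N ω) ^ k ∂(P N)) atTop
      (𝓝 (∫ z, z ^ k ∂(gaussianReal 0 v))) := by
  classical
  induction k using matchingNumber.induct with
  | case1 => simp
  | case2 =>
    have h1 : ∀ N, ∫ ω, (∑ i, t i * Y i N ω) ^ 1 ∂(P N) = 0 := fun N => by
      simp_rw [pow_one]
      rw [integral_finsetSum _ fun i _ => (hY i N).integrable.const_mul _]
      simp [integral_const_mul, h0]
    simp_rw [h1]
    simp
  | case3 k ih =>
    have hvar : Tendsto (fun N => ∑ i, ∑ j, t i * t j * ∫ ω, Y i N ω * Y j N ω ∂(P N)) atTop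
        (𝓝 (v : ℝ)) := by
      rw [← hv]
      exact tendsto_finsetSum _ fun i _ => tendsto_finsetSum _ fun j _ => (hC i j).const_mul _
    -- The first sum is the error in the recursion. Each of the `k + 1` partners `b` of the index
    -- `0` yields the same product of variance and `k`-th moment, which is the Gaussian moment
    -- recursion.
    have h1 : ∀ N, ∫ ω, (∑ i, t i * Y i N ω) ^ (k + 2) ∂(P N) =
        (∑ f : Fin (k + 2) → ι, (∏ j, t (f j)) * (∫ ω, ∏ j, Y (f j) N ω ∂(P N) -
          ∑ b : Fin (k + 1), (∫ ω, Y (f 0) N ω * Y (f b.succ) N ω ∂(P N)) *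
            ∫ ω, ∏ j : Fin k, Y (f (b.succAbove j).succ) N ω ∂(P N))) +
        (k + 1) * (∑ i, ∑ j, t i * t j * ∫ ω, Y i N ω * Y j N ω ∂(P N)) *
          ∫ ω, (∑ i, t i * Y i N ω) ^ k ∂(P N) := by
      intro N
      rw [integral_linearCombination_pow (fun i => hY i N),
        integral_linearCombination_pow (fun i => hY i N)]
      have h2 : ∀ b : Fin (k + 1), ∑ f : Fin (k + 2) → ι, (∏ j, t (f j)) *
          ((∫ ω, Y (f 0) N ω * Y (f b.succ) N ω ∂(P N)) *
            ∫ ω, ∏ j : Fin k, Y (f (b.succAbove j).succ) N ω ∂(P N)) =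
          (∑ i, ∑ j, t i * t j * ∫ ω, Y i N ω * Y j N ω ∂(P N)) *
          ∑ f : Fin k → ι, (∏ j, t (f j)) * ∫ ω, ∏ j, Y (f j) N ω ∂(P N) := by
        intro b
        rw [← sum_insert_two b]
        refine Finset.sum_congr rfl fun f _ => ?_
        rw [Fin.prod_univ_succ, Fin.prod_univ_succAbove _ b]
        ring
      simp_rw [mul_sub, Finset.mul_sum (s := (Finset.univ : Finset (Fin (k + 1))))]
      rw [Finset.sum_sub_distrib, Finset.sum_comm (t := (Finset.univ : Finset (Fin (k + 1)))),
        Finset.sum_congr rfl fun b _ => h2 b, Finset.sum_const, Finset.card_univ, Fintype.card_fin,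
        nsmul_eq_mul]
      push_cast
      ring
    simp_rw [h1]
    rw [integral_pow_gaussianReal_add_two, ← zero_add ((k + 1 : ℝ) * v * _)]
    refine Tendsto.add ?_ ((hvar.const_mul _).mul ih)
    have h3 := tendsto_finsetSum Finset.univ fun (f : Fin (k + 2) → ι) _ =>
      (hrec k f).const_mul (∏ j, t (f j))
    simp only [mul_zero, Finset.sum_const_zero] at h3
    exact h3

end LinearCombination

/-! ### From standard Gaussian entries to the given matrices; the main theorem -/

/-- The entries of the matrices, divided by their standard deviations. -/
def standardEntries {Ω : Type*} {N : ℕ} (σ : ℕ → ℝ) (W : Ω → ℕ → Matrix (Fin N) (Fin N) ℝ)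
    (p : ℕ × Fin N × Fin N) (ω : Ω) : ℝ :=
  W ω p.1 p.2.1 p.2.2 / σ p.1

lemma IsGaussianMatrixSequence.isStdGaussianFamily {Ω : Type*} [MeasurableSpace Ω]
    {P : Measure Ω} {N : ℕ} {σ : ℕ → ℝ} (hσ : ∀ ℓ, 0 < σ ℓ)
    {W : Ω → ℕ → Matrix (Fin N) (Fin N) ℝ} (hW : IsGaussianMatrixSequence P σ W) :
    IsStdGaussianFamily (standardEntries σ W) P where
  hasLaw p := by
    have h := gaussianReal_div_const (hW.hasLaw p.1 p.2.1 p.2.2) (σ p.1)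
    have h1 : NNReal.mk (σ p.1 ^ 2) (sq_nonneg _) ≠ 0 := by
      rw [Ne, ← NNReal.coe_eq_zero]
      exact pow_ne_zero 2 (hσ p.1).ne'
    rw [zero_div] at h
    exact (div_self h1) ▸ h
  indep := hW.indep.comp (fun p y => y / σ p.1) fun p => by fun_prop

namespace LabelledGraph

lemma value_toProductGraph (G : LabelledGraph) {Ω : Type*} {N : ℕ} {σ : ℕ → ℝ}
    (hσ : ∀ ℓ, 0 < σ ℓ) (W : Ω → ℕ → Matrix (Fin N) (Fin N) ℝ) (ω : Ω) :
    (G.toProductGraph N (W ω)).value = G.stdProd σ * G.graphSum (standardEntries σ W) ω := by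
  classical
  rw [graphSum, Finset.mul_sum]
  refine Finset.sum_congr (by congr!) fun i _ => ?_
  change (∏ e, (G.label e).elim (Matrix.of fun _ _ => (1 : ℝ)) (W ω) (i (G.src e)) (i (G.tgt e))) *
    ∏ v : G.V, (1 : ℝ) = _
  rw [Finset.prod_const_one, mul_one, stdProd, ← Finset.prod_mul_distrib]
  refine Finset.prod_congr rfl fun e _ => ?_
  simp only [entryLabel]
  cases G.label e with
  | none =>
    simp only [Option.elim, Option.map_none, withOne, mul_one]
    rfl
  | some ℓ =>
    have := (hσ ℓ).ne'
    simp only [Option.elim, Option.map_some, withOne, standardEntries]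
    field_simp

/-- Splits off a deterministic part, which tends to `0` by `tendsto_integral_graphSum`; only the
centred value matters for the limit law. -/
lemma rescaledValue_eq (G : LabelledGraph) {Ω : Type*} [MeasurableSpace Ω] (P : Measure Ω) {N : ℕ}
    {σ : ℕ → ℝ} (hσ : ∀ ℓ, 0 < σ ℓ) (W : Ω → ℕ → Matrix (Fin N) (Fin N) ℝ) (ω : Ω) :
    rescaledValue G N σ (W ω) = G.centredValue P (standardEntries σ W) ω +
      (((N : ℝ) ^ (G.edgeExponent + 1 / 2))⁻¹ *
        (∫ ω, G.graphSum (standardEntries σ W) ω ∂P) -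
        (G.atomicPairings.ncard : ℝ) * √(N : ℝ)) := by
  have hstd : G.stdProd σ ≠ 0 := by
    refine Finset.prod_ne_zero_iff.2 fun e _ => ?_
    cases G.label e with
    | none => simp
    | some ℓ => exact (hσ ℓ).ne'
  rw [rescaledValue, value_toProductGraph G hσ, centredValue, mul_inv]
  field_simp
  ring

variable {Ω : ℕ → Type*} [∀ N, MeasurableSpace (Ω N)] {P : (N : ℕ) → Measure (Ω N)}
  [∀ N, IsProbabilityMeasure (P N)] {x : (N : ℕ) → ℕ × Fin N × Fin N → Ω N → ℝ}

/-- The recursion for `a = 0`, with `{0, b.succ}ᶜ` enumerated by `Fin k` in the form that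
`tendsto_moments_linearCombination` expects. -/
lemma tendsto_centredValue_recursion (F : ℕ → LabelledGraph) (hF : ∀ i, (F i).Connected)
    (hx : ∀ N, IsStdGaussianFamily (x N) (P N)) {k : ℕ} (f : Fin (k + 2) → ℕ) :
    Tendsto (fun N => ∫ ω, ∏ j, (F (f j)).centredValue (P N) (x N) ω ∂(P N) -
      ∑ b : Fin (k + 1), (∫ ω, (F (f 0)).centredValue (P N) (x N) ω *
          (F (f b.succ)).centredValue (P N) (x N) ω ∂(P N)) *
        ∫ ω, ∏ j : Fin k, (F (f (b.succAbove j).succ)).centredValue (P N) (x N) ω ∂(P N))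
      atTop (𝓝 0) := by
  have h := tendsto_integral_prod_centredValue_sub (fun j => F (f j)) (fun j => hF _) hx 0
  have h1 : (Finset.univ.erase (0 : Fin (k + 2))) = Finset.univ.map (Fin.succEmb (k + 1)) := by
    ext j
    refine Fin.cases ?_ (fun j => ?_) j <;> simp
  have h2 : ∀ b : Fin (k + 1), ({0, b.succ}ᶜ : Finset (Fin (k + 2))) =
      Finset.univ.map ((Fin.succAboveEmb b).trans (Fin.succEmb (k + 1))) := by
    intro b
    ext j
    refine Fin.cases (by simp) (fun j => ?_) j
    rcases Fin.eq_self_or_eq_succAbove b j with rfl | ⟨i, rfl⟩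
    · simp [Fin.succAbove_ne]
    · simp [Fin.succAbove_ne]
  simp_rw [h1, Finset.sum_map, Fin.coe_succEmb, h2, Finset.prod_map,
    Function.Embedding.trans_apply, Fin.coe_succEmb, Fin.succAboveEmb_apply,
    Finset.prod_pair (Fin.succ_ne_zero _).symm] at h
  exact h

end LabelledGraph

lemma ofLp_linearForm {ι : Type*} [Fintype ι] (y : ι → ℝ) (t : EuclideanSpace ℝ ι) :
    inner ℝ (WithLp.toLp 2 y : EuclideanSpace ℝ ι) t = ∑ i, t i * y i := by
  simp [PiLp.inner_apply]

theorem mainTheorem7 (G : ℕ → LabelledGraph) (hG : ∀ i, (G i).Connected)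
    (σ : ℕ → ℕ → ℝ) (hσ : ∀ N ℓ, 0 < σ N ℓ)
    (Ω : ℕ → Type*) [∀ N, MeasurableSpace (Ω N)]
    (P : (N : ℕ) → Measure (Ω N)) [∀ N, IsProbabilityMeasure (P N)]
    (W : (N : ℕ) → Ω N → ℕ → Matrix (Fin N) (Fin N) ℝ)
    (hW : ∀ N, IsGaussianMatrixSequence (P N) (σ N) (W N))
    (m : ℕ) :
    (biatomicMatrix G m).PosSemidef ∧
    TendstoInDistribution
      (fun N ω => WithLp.toLp 2 fun i : Fin m => rescaledValue (G i) N (σ N) (W N ω))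
      atTop
      (fun z : EuclideanSpace ℝ (Fin m) => z)
      P
      (multivariateGaussian 0 (biatomicMatrix G m)) := by
  let x : (N : ℕ) → ℕ × Fin N × Fin N → Ω N → ℝ := fun N => standardEntries (σ N) (W N)
  have hx : ∀ N, IsStdGaussianFamily (x N) (P N) := fun N => (hW N).isStdGaussianFamily (hσ N)
  let Y : Fin m → (N : ℕ) → Ω N → ℝ := fun i N => (G i).centredValue (P N) (x N)
  have hY : ∀ i N, HasAllMoments (Y i N) (P N) := fun i N =>
    (G i).hasAllMoments_centredValue (hx N)
  let δ : Fin m → ℕ → ℝ := fun i N => ((N : ℝ) ^ ((G i).edgeExponent + 1 / 2))⁻¹ *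
    (∫ ω, (G i).graphSum (x N) ω ∂(P N)) - ((G i).atomicPairings.ncard : ℝ) * √(N : ℝ)
  have hδ : ∀ i, Tendsto (δ i) atTop (𝓝 0) := fun i => (G i).tendsto_integral_graphSum (hG i) hx
  set C := biatomicMatrix G m
  have hC : ∀ i j, Tendsto (fun N => ∫ ω, Y i N ω * Y j N ω ∂(P N)) atTop (𝓝 (C i j)) :=
    fun i j => LabelledGraph.tendsto_integral_mul_centredValue _ _ (hG i) (hG j) hx
  have hquad : ∀ t : Fin m → ℝ, t ⬝ᵥ C.mulVec t = ∑ i, ∑ j, t i * t j * C i j := fun t => by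
    simp only [dotProduct, Matrix.mulVec, Finset.mul_sum]
    exact Finset.sum_congr rfl fun i _ => Finset.sum_congr rfl fun j _ => by ring
  -- The quadratic form is a limit of second moments of `∑ i, t i * Y i N`.
  have hpos : ∀ t : Fin m → ℝ, 0 ≤ t ⬝ᵥ C.mulVec t := by
    intro t
    have h1 : Tendsto (fun N => ∑ i, ∑ j, t i * t j * ∫ ω, Y i N ω * Y j N ω ∂(P N)) atTop
        (𝓝 (t ⬝ᵥ C.mulVec t)) := by
      rw [hquad]
      exact tendsto_finsetSum _ fun i _ => tendsto_finsetSum _ fun j _ => (hC i j).const_mul _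
    refine ge_of_tendsto' h1 fun N => ?_
    have h2 : ∫ ω, (∑ i, t i * Y i N ω) * (∑ j, t j * Y j N ω) ∂(P N) =
        ∑ i, ∑ j, t i * t j * ∫ ω, Y i N ω * Y j N ω ∂(P N) := by
      simp_rw [Finset.sum_mul_sum, mul_mul_mul_comm (t _) (Y _ _ _)]
      have hi : ∀ i j, Integrable (fun ω => t i * t j * (Y i N ω * Y j N ω)) (P N) :=
        fun i j => (((hY i N).mul (hY j N)).integrable).const_mul _
      rw [integral_finsetSum _ fun i _ => integrable_finsetSum _ fun j _ => hi i j]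
      refine Finset.sum_congr rfl fun i _ => ?_
      rw [integral_finsetSum _ fun j _ => hi i j]
      exact Finset.sum_congr rfl fun j _ => integral_const_mul _ _
    rw [← h2]
    exact integral_nonneg fun ω => mul_self_nonneg _
  have hpsd : C.PosSemidef := by
    refine .of_dotProduct_mulVec_nonneg ?_ fun t => by simpa using hpos t
    ext i j
    refine tendsto_nhds_unique (hC j i) ?_
    simp_rw [mul_comm (Y j _ _)]
    exact hC i j
  have hmeas : ∀ N, AEMeasurable (fun ω => (WithLp.toLp 2 fun i : Fin m =>
      rescaledValue (G i) N (σ N) (W N ω) : EuclideanSpace ℝ (Fin m))) (P N) := by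
    intro N
    have h1 : ∀ i, AEMeasurable (fun ω => rescaledValue (G i) N (σ N) (W N ω)) (P N) := by
      intro i
      simp_rw [(G i).rescaledValue_eq (P N) (hσ N)]
      exact ((G i).hasAllMoments_centredValue (hx N)).aemeasurable.add_const _
    exact (WithLp.measurable_toLp 2 _).comp_aemeasurable (aemeasurable_pi_lambda _ fun i => h1 i)
  refine ⟨hpsd, ?_, ?_, ?_⟩
  · exact hmeas
  · fun_prop
  · refine ProbabilityMeasure.tendsto_of_tendsto_charFun fun t => ?_
    have hv : ∑ i, ∑ j, t i * t j * C i j = (⟨t ⬝ᵥ C.mulVec t, hpos t⟩ : NNReal) :=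
      (hquad t).symm
    have h1 := tendsto_integral_cexp_of_tendsto_moments
      (X := fun N ω => ∑ i, t i * Y i N ω)
      (fun N => HasAllMoments.sum fun i _ => (hY i N).const_mul _) _
      fun k => tendsto_moments_linearCombination hY
        (fun i N => (G i).integral_centredValue (hx N)) hC
        (fun k f => LabelledGraph.tendsto_centredValue_recursion G hG hx fun j => f j) t _ hv k
    -- The deterministic shifts `δ` multiply the characteristic function by a factor that tends to
    -- `1`.
    have h2 : Tendsto (fun N => Complex.exp (((∑ i, t i * δ i N : ℝ) : ℂ) * Complex.I)) atTop
        (𝓝 1) := by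
      have h3 : Tendsto (fun N => ∑ i, t i * δ i N) atTop (𝓝 0) := by
        simpa using tendsto_finsetSum Finset.univ fun i _ => (hδ i).const_mul (t i)
      have h4 : Continuous fun s : ℝ => Complex.exp ((s : ℂ) * Complex.I) := by fun_prop
      have h6 := (h4.tendsto 0).comp h3
      simp only [Complex.ofReal_zero, zero_mul, Complex.exp_zero] at h6
      exact h6
    have h5 := h2.mul h1
    rw [one_mul] at h5
    convert h5 using 1
    · ext N
      rw [ProbabilityMeasure.coe_mk, charFun_apply, integral_map, ← integral_const_mul]
      · refine integral_congr_ae (Eventually.of_forall fun ω => ?_)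
        simp only
        rw [ofLp_linearForm, ← Complex.exp_add]
        congr 1
        rw [← add_mul, ← Complex.ofReal_add, ← Finset.sum_add_distrib]
        congr 2
        refine Finset.sum_congr rfl fun i _ => ?_
        rw [(G i).rescaledValue_eq (P N) (hσ N), mul_add, add_comm]
      · exact hmeas N
      · exact (by fun_prop : Continuous fun z : EuclideanSpace ℝ (Fin m) =>
          Complex.exp ((inner ℝ z t : ℝ) * Complex.I)).aestronglyMeasurable
    · rw [ProbabilityMeasure.coe_mk, Measure.map_id', charFun_multivariateGaussian hpsd]
      simp only [inner_zero_right, Complex.ofReal_zero, zero_mul, zero_sub, neg_div]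
      rfl

end
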